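/- All posets are finite, with a least element $\hat 0$ and a greatest element $\hat 1$, and graded with rank function $\rho$, $\rho(\hat 0)=0$; the rank of the poset is $\rho(\hat 1)$. Such a poset $P$ is \emph{Eulerian} if every interval $[x,y]$ with $x<y$ has as many elements of even rank as of odd rank. It is a \emph{Sheffer poset} with Sheffer factorial function $D$ and binomial factorial function $B$ if every interval $[\hat 0,y]$ has exactly $D(\rho(y))$ maximal chains, and every interval $[x,y]$ with $x\ne\hat 0$ has exactly $B(\rho(y)-\rho(x))$ maximal chains. The \emph{cubical lattice of rank $n$} is the face lattice of the $(n-1)$-dimensional cube, that is, $T^{n-1}\cup\{\hat 0\}$, where $T$ is the three-element poset consisting of two incomparable elements and a greatest element, and $\hat 0$ is a new least element. \textbf{Theorem.} Let $P$ be an Eulerian Sheffer poset of even rank $n=2m+2\ge 6$ with $B(3)=3!$ and $D(3)=8$. Then $P$ has the same factorial functions as the cubical lattice of rank $n$ (which is a Sheffer poset). That is, $D(k)=2^{k-1}(k-1)!$ for $1\le k\le n$, and $B(k)=k!$ for $1\le k\le n-1$. -/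

import Mathlib

/-- The number of maximal chains of the interval `[x, y]`. -/
noncomputable def numMaxChains {P : Type*} [PartialOrder P] (x y : P) : ℕ :=
  Nat.card (Flag (Set.Icc x y))

/-- A graded poset is Eulerian if every non-singleton interval has as many elements of even rank
as of odd rank. -/
def IsEulerianPoset (P : Type*) [PartialOrder P] [GradeMinOrder ℕ P] : Prop :=
  ∀ x y : P, x < y →
    {z ∈ Set.Icc x y | Even (grade ℕ z)}.ncard = {z ∈ Set.Icc x y | Odd (grade ℕ z)}.ncard

/-- `P` (with rank function `grade ℕ`) is a Sheffer poset with binomial factorial function `B`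
and Sheffer factorial function `D`. Only the values of `D` at `0, …, rank P` and of `B` at
`0, …, rank P - 1` matter, and those are determined by `P`. -/
structure IsShefferPoset (P : Type*) [PartialOrder P] [BoundedOrder P] [GradeMinOrder ℕ P]
    (B D : ℕ → ℕ) : Prop where
  sheffer_interval : ∀ y : P, numMaxChains ⊥ y = D (grade ℕ y)
  binomial_interval : ∀ x y : P, x ≠ ⊥ → x ≤ y →
    numMaxChains x y = B (grade ℕ y - grade ℕ x)

/-- The nonempty faces of a segment: its two end points, and the segment itself. -/
inductive SegmentFace : Type
  | left
  | right
  | whole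
  deriving DecidableEq

namespace SegmentFace

/-- The end points are incomparable, and both lie below the whole segment. -/
instance instPartialOrder : PartialOrder SegmentFace where
  le a b := a = b ∨ b = whole
  le_refl _ := Or.inl rfl
  le_trans a b c := by rintro (rfl | rfl) (rfl | rfl) <;> simp
  le_antisymm a b := by rintro (rfl | rfl) (h | h) <;> simp_all

instance instOrderTop : OrderTop SegmentFace where
  top := whole
  le_top _ := Or.inr rfl

end SegmentFace

/-- The cubical lattice: the face lattice of the `d`-dimensional cube, that is, the `d`-th power
of the poset of nonempty faces of a segment, with a new least element (the empty face). -/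
abbrev CubicalLattice (d : ℕ) : Type := WithBot (Fin d → SegmentFace)

namespace CubicalLattice

/-- The dimension of a nonempty face of the cube. -/
def dim {d : ℕ} (f : Fin d → SegmentFace) : ℕ :=
  (Finset.univ.filter fun i => f i = SegmentFace.whole).card

/-- The rank of a face of the cube: its dimension plus one, and `0` for the empty face. -/
def rank {d : ℕ}  (a : CubicalLattice d) : ℕ :=
  WithBot.recBotCoe 0 (fun f => dim f + 1) a

theorem dim_strictMono {d : ℕ} : StrictMono (dim (d := d)) := by
  intro f g hfg
  obtain ⟨hle, i, hi⟩ := Pi.lt_def.1 hfg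
  refine Finset.card_lt_card (Finset.ssubset_iff_of_subset ?_ |>.2 ⟨i, ?_, ?_⟩)
  · intro j hj
    simp only [Finset.mem_filter, Finset.mem_univ, true_and] at hj ⊢
    rcases hle j with h | h
    · rw [← h, hj]
    · exact h
  · simp only [Finset.mem_filter, Finset.mem_univ, true_and]
    rcases hi.le with h | h
    · exact absurd h hi.ne
    · exact h
  · simp only [Finset.mem_filter, Finset.mem_univ, true_and]
    intro h
    exact (le_top : g i ≤ ⊤).not_gt (lt_of_eq_of_lt h.symm hi)

theorem dim_covBy {d : ℕ} {f g : Fin d → SegmentFace} (h : f ⋖ g) : dim g = dim f + 1 := by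
  obtain ⟨hle, i, hi⟩ := Pi.lt_def.1 h.lt
  have hg : g i = SegmentFace.whole := hi.le.resolve_left hi.ne
  have hu : Function.update f i SegmentFace.whole = g := by
    by_contra hne
    refine h.2 (c := Function.update f i SegmentFace.whole) ?_ (lt_of_le_of_ne ?_ hne)
    · refine lt_of_le_of_ne ?_ ?_
      · intro j
        by_cases hj : j = i
        · subst hj; rw [Function.update_self]; exact Or.inr rfl
        · simp [hj]
      · intro he
        have := congrFun he i
        simp only [Function.update_self] at this
        exact hi.ne (this.trans hg.symm)
    · intro j
      by_cases hj : j = i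
      · subst hj; simp [hg]
      · simpa [hj] using hle j
  have hfi : f i ≠ SegmentFace.whole := fun he => hi.ne (he.trans hg.symm)
  have : (Finset.univ.filter fun j => g j = SegmentFace.whole)
      = insert i (Finset.univ.filter fun j => f j = SegmentFace.whole) := by
    ext j
    by_cases hj : j = i
    · subst hj; simp [hg]
    · simp [← hu, hj]
  rw [dim, this, Finset.card_insert_of_notMem (by simpa using hfi), dim]

theorem dim_eq_zero_of_bot_covBy {d : ℕ} {f : Fin d → SegmentFace}
    (h : (⊥ : CubicalLattice d) ⋖ (f : CubicalLattice d)) : dim f = 0 := by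
  have hmin : IsMin f := WithBot.bot_covBy_coe.1 h
  rw [dim, Finset.card_eq_zero, Finset.filter_eq_empty_iff]
  intro i _ hi
  have hlt : Function.update f i SegmentFace.left ≤ f := by
    intro j
    by_cases hj : j = i
    · subst hj; rw [Function.update_self]; exact Or.inr hi
    · simp [hj]
  have := hmin hlt i
  rw [Function.update_self, hi] at this
  rcases this with h | h <;> cases h

instance instGradeMinOrder (d : ℕ) : GradeMinOrder ℕ (CubicalLattice d) where
  grade := rank
  grade_strictMono := by
    intro a b hab
    induction a using WithBot.recBotCoe with
    | bot =>
      induction b using WithBot.recBotCoe with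
      | bot => exact absurd hab (lt_irrefl _)
      | coe g => exact Nat.succ_pos _
    | coe f =>
      induction b using WithBot.recBotCoe with
      | bot => exact absurd hab not_lt_bot
      | coe g => exact Nat.succ_lt_succ (dim_strictMono (WithBot.coe_lt_coe.1 hab))
  covBy_grade := by
    intro a b hab
    rw [Nat.covBy_iff_add_one_eq]
    induction a using WithBot.recBotCoe with
    | bot =>
      induction b using WithBot.recBotCoe with
      | bot => exact absurd hab.lt (lt_irrefl _)
      | coe g => exact congrArg (· + 1) (dim_eq_zero_of_bot_covBy hab).symm
    | coe f =>
      induction b using WithBot.recBotCoe with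
      | bot => exact absurd hab.lt not_lt_bot
      | coe g => exact congrArg (· + 1) (dim_covBy (WithBot.coe_covBy_coe.1 hab)).symm
  isMin_grade := by
    intro a ha
    rw [isMin_iff_eq_bot] at ha
    subst ha
    exact isMin_bot

end CubicalLattice

/-!
In an Eulerian Sheffer poset, the alternating count of the ranks in an interval is a relation
between the factorial functions, which at even lengths expresses the last value through the earlier
ones. So everything reduces to the odd values, which are compared with those of the cubical lattice
by induction.

Suppose the intervals above the atoms of `[v, y]` are Boolean. If two coatoms of `[v, y]` share an
atom, then they cover a common element, because the interval above that atom is Boolean.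
* If `v` is nonzero, then `[v, b]` is also Boolean for each coatom `b`, and sharing an atom is an
  equivalence relation on the coatoms. Its classes have `k` elements, `k` being the length of
  `[v, y]`, so there are `k` coatoms or at least `2 * k`. In the second case the binomial factorial
  function is at least twice what is expected, contradicting the Euler relation one rank higher.
* If `v` is the least element, then the atoms common to two coatoms are partitioned by the elements
  that both coatoms cover, so their number is a multiple of a power of two. Together with the Euler
  relation this excludes both too many and too few atoms below an element of odd rank, and the
  number of atoms determines the Sheffer factorial function.
-/

section MaximalChains

open Finset

variable {P : Type*} [PartialOrder P]

/-- The maximal chains of `[x, y]`, encoded as subsets of the ambient poset so that chains of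
different intervals can be compared. -/
def maxChains (x y : P) : Set (Set P) :=
  {s | s ⊆ Set.Icc x y ∧ IsChain (· ≤ ·) s ∧
    ∀ a ∈ Set.Icc x y, (∀ b ∈ s, a ≤ b ∨ b ≤ a) → a ∈ s}

theorem numMaxChains_eq_ncard_maxChains (x y : P) :
    numMaxChains x y = (maxChains x y).ncard := by
  let toSet : Flag (Set.Icc x y) → Set P := fun s => Subtype.val '' (s : Set (Set.Icc x y))
  have toSet_injective : toSet.Injective := fun s t h =>
    Flag.ext (Subtype.val_injective.image_injective h)
  have range_toSet : Set.range toSet = maxChains x y := by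
    refine Set.Subset.antisymm ?_ ?_
    · rintro _ ⟨s, rfl⟩
      refine ⟨?_, ?_, fun a ha h => ⟨⟨a, ha⟩, ?_, rfl⟩⟩
      · rintro _ ⟨a, -, rfl⟩
        exact a.2
      · rintro _ ⟨a, ha, rfl⟩ _ ⟨b, hb, rfl⟩ -
        exact s.le_or_le ha hb
      · exact Flag.mem_iff_forall_le_or_ge.2 fun b hb => h b ⟨b, hb, rfl⟩
    · rintro s ⟨hs, hchain, hmax⟩
      refine ⟨⟨Subtype.val ⁻¹' s, fun a ha b hb hab => ?_, fun t ht hst => ?_⟩, ?_⟩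
      · exact hchain ha hb fun h => hab (Subtype.ext h)
      · refine Set.Subset.antisymm hst fun a ha => hmax a a.2 fun b hb => ?_
        exact ht.total ha (hst (show (⟨b, hs hb⟩ : Set.Icc x y) ∈ Subtype.val ⁻¹' s from hb))
      · exact (Subtype.image_preimage_coe _ s).trans (Set.inter_eq_right.2 hs)
  rw [numMaxChains, ← range_toSet, ← Nat.card_coe_set_eq,
    Nat.card_congr (Equiv.ofInjective toSet toSet_injective)]

theorem isLeast_of_mem_maxChains {x y : P} {s : Set P} (hs : s ∈ maxChains x y)
    (hxy : x ≤ y) : IsLeast s x :=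
  ⟨hs.2.2 x ⟨le_rfl, hxy⟩ fun _ hb => Or.inl (hs.1 hb).1, fun _ hb => (hs.1 hb).1⟩

theorem isGreatest_of_mem_maxChains {x y : P} {s : Set P} (hs : s ∈ maxChains x y)
    (hxy : x ≤ y) : IsGreatest s y :=
  ⟨hs.2.2 y ⟨hxy, le_rfl⟩ fun _ hb => Or.inr (hs.1 hb).2, fun _ hb => (hs.1 hb).2⟩

theorem numMaxChains_self (x : P) : numMaxChains x x = 1 := by
  rw [numMaxChains_eq_ncard_maxChains, Set.ncard_eq_one]
  refine ⟨{x}, Set.ext fun s => ⟨fun hs => ?_, ?_⟩⟩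
  · refine Set.Subset.antisymm (hs.1.trans_eq (Set.Icc_self x)) ?_
    exact Set.singleton_subset_iff.2 (isLeast_of_mem_maxChains hs le_rfl).1
  · rintro rfl
    exact ⟨(Set.Icc_self x).ge, IsChain.singleton, fun a ha _ => (Set.Icc_self x).le ha⟩

theorem insert_mem_maxChains {x y z : P} (hxz : x ≤ z) (hzy : z ⋖ y) {t : Set P}
    (ht : t ∈ maxChains x z) : insert y t ∈ maxChains x y := by
  refine ⟨?_, ?_, ?_⟩
  · rintro a (rfl | ha)
    · exact ⟨hxz.trans hzy.le, le_rfl⟩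
    · exact ⟨(ht.1 ha).1, (ht.1 ha).2.trans hzy.le⟩
  · exact ht.2.1.insert fun b hb _ => Or.inr ((ht.1 hb).2.trans hzy.le)
  · intro a ha h
    have hz := (isGreatest_of_mem_maxChains ht hxz).1
    rcases h z (Or.inr hz) with haz | hza
    · exact Or.inr (ht.2.2 a ⟨ha.1, haz⟩ fun b hb => h b (Or.inr hb))
    · rcases hzy.eq_or_eq hza ha.2 with rfl | rfl
      · exact Or.inr hz
      · exact Or.inl rfl

variable [LocallyFiniteOrder P]

theorem finite_maxChains (x y : P) : (maxChains x y).Finite :=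
  (Set.finite_Icc x y).finite_subsets.subset fun _ hs => hs.1

theorem numMaxChains_pos (x y : P) : 0 < numMaxChains x y := by
  have : Finite (Flag (Set.Icc x y)) :=
    Finite.of_injective (fun s : Flag (Set.Icc x y) => (s : Set (Set.Icc x y)))
      fun _ _ h => Flag.ext h
  exact Nat.card_pos

theorem exists_covBy_sdiff_mem_maxChains {x y : P} (hxy : x < y) {s : Set P}
    (hs : s ∈ maxChains x y) : ∃ z, x ≤ z ∧ z ⋖ y ∧ s \ {y} ∈ maxChains x z := by
  have hfin : (s \ {y}).Finite := ((Set.finite_Icc x y).subset hs.1).sdiff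
  obtain ⟨z, ⟨hzs, hzy⟩, hzmax⟩ :=
    hfin.exists_maximal ⟨x, (isLeast_of_mem_maxChains hs hxy.le).1, hxy.ne⟩
  have le_z : ∀ b ∈ s, b ≠ y → b ≤ z := fun b hb hby =>
    (hs.2.1.total hb hzs).elim id (hzmax ⟨hb, hby⟩)
  have hxz := (hs.1 hzs).1
  have hz : z < y := lt_of_le_of_ne (hs.1 hzs).2 hzy
  refine ⟨z, hxz, ⟨hz, fun c hzc hcy => ?_⟩, ?_, hs.2.1.diff, fun a ha h => ?_⟩
  · refine (le_z c (hs.2.2 c ⟨hxz.trans hzc.le, hcy.le⟩ fun b hb => ?_) hcy.ne).not_gt hzc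
    rcases eq_or_ne b y with rfl | hby
    · exact Or.inl hcy.le
    · exact Or.inr ((le_z b hb hby).trans hzc.le)
  · rintro b ⟨hb, hby⟩
    exact ⟨(hs.1 hb).1, le_z b hb hby⟩
  · have hay : a < y := ha.2.trans_lt hz
    refine ⟨hs.2.2 a ⟨ha.1, hay.le⟩ fun b hb => ?_, hay.ne⟩
    rcases eq_or_ne b y with rfl | hby
    · exact Or.inl hay.le
    · exact h b ⟨hb, hby⟩

open Classical in
/-- The coatoms of the interval `[x, y]`. -/
noncomputable def coatomSet (x y : P) : Finset P := {z ∈ Icc x y | z ⋖ y}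

open Classical in
/-- The atoms of the interval `[x, y]`. -/
noncomputable def atomSet (x y : P) : Finset P := {z ∈ Icc x y | x ⋖ z}

theorem mem_coatomSet {x y z : P} : z ∈ coatomSet x y ↔ x ≤ z ∧ z ⋖ y := by
  classical rw [coatomSet, mem_filter, mem_Icc]
  exact ⟨fun h => ⟨h.1.1, h.2⟩, fun h => ⟨⟨h.1, h.2.le⟩, h.2⟩⟩

theorem mem_atomSet {x y z : P} : z ∈ atomSet x y ↔ x ⋖ z ∧ z ≤ y := by
  classical rw [atomSet, mem_filter, mem_Icc]
  exact ⟨fun h => ⟨h.2, h.1.2⟩, fun h => ⟨⟨h.1.le, h.2⟩, h.1⟩⟩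

theorem atomSet_subset_atomSet {x y y' : P} (h : y ≤ y') : atomSet x y ⊆ atomSet x y' :=
  fun _ hz => mem_atomSet.2 ⟨(mem_atomSet.1 hz).1, (mem_atomSet.1 hz).2.trans h⟩

theorem card_atomSet_pos {x y : P} (hxy : x < y) : 0 < #(atomSet x y) :=
  let ⟨z, hxz, hzy⟩ := exists_covBy_le_of_lt hxy
  card_pos.2 ⟨z, mem_atomSet.2 ⟨hxz, hzy⟩⟩

theorem numMaxChains_eq_sum_coatomSet {x y : P} (hxy : x < y) :
    numMaxChains x y = ∑ z ∈ coatomSet x y, numMaxChains x z := by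
  have hcoatom (z : coatomSet x y) : x ≤ z ∧ (z : P) ⋖ y := mem_coatomSet.1 z.2
  have notMem (z : coatomSet x y) {t : Set P} (ht : t ∈ maxChains x (z : P)) : y ∉ t :=
    fun hy => (hcoatom z).2.lt.not_ge (ht.1 hy).2
  let addTop : (Σ z : coatomSet x y, maxChains x (z : P)) → maxChains x y := fun c =>
    ⟨insert y c.2, insert_mem_maxChains (hcoatom c.1).1 (hcoatom c.1).2 c.2.2⟩
  have addTop_bijective : addTop.Bijective := by
    constructor
    · rintro ⟨z, t, ht⟩ ⟨z', t', ht'⟩ h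
      obtain rfl : t = t' := by
        have := congrArg (fun s : maxChains x y => (s : Set P) \ {y}) h
        simpa only [addTop, Set.insert_sdiff_self_of_notMem, notMem z ht, notMem z' ht',
          not_false_eq_true] using this
      obtain rfl : z = z' := Subtype.ext <|
        (isGreatest_of_mem_maxChains ht (hcoatom z).1).unique
          (isGreatest_of_mem_maxChains ht' (hcoatom z').1)
      rfl
    · rintro ⟨s, hs⟩
      obtain ⟨z, hxz, hzy, ht⟩ := exists_covBy_sdiff_mem_maxChains hxy hs
      refine ⟨⟨⟨z, mem_coatomSet.2 ⟨hxz, hzy⟩⟩, _, ht⟩, Subtype.ext ?_⟩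
      exact Set.insert_sdiff_self_of_mem (isGreatest_of_mem_maxChains hs hxy.le).1
  have (z : coatomSet x y) : Finite (maxChains x (z : P)) := finite_maxChains x z
  simp only [numMaxChains_eq_ncard_maxChains, ← Nat.card_coe_set_eq]
  rw [← Nat.card_congr (Equiv.ofBijective addTop addTop_bijective), Nat.card_sigma,
    ← Finset.sum_coe_sort (coatomSet x y)]

end MaximalChains

section RankLevels

open Finset

variable {P : Type*} [PartialOrder P] [GradeOrder ℕ P]

theorem grade_eq_add_one_of_covBy {a b : P} (h : a ⋖ b) : grade ℕ b = grade ℕ a + 1 :=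
  (Nat.covBy_iff_add_one_eq.1 (h.grade ℕ)).symm

theorem eq_of_le_of_grade_le {a b : P} (h : a ≤ b) (hg : grade ℕ b ≤ grade ℕ a) : a = b :=
  h.eq_or_lt.resolve_right fun hlt => (grade_strictMono hlt).not_ge hg

theorem covBy_of_le_of_grade_eq {a b : P} (h : a ≤ b) (hg : grade ℕ b = grade ℕ a + 1) :
    a ⋖ b :=
  covBy_iff_lt_covBy_grade.2
    ⟨h.lt_of_ne (by rintro rfl; omega), Nat.covBy_iff_add_one_eq.2 hg.symm⟩

variable [LocallyFiniteOrder P]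

/-- The elements of rank `i` in the interval `[x, y]`; here `i` is the rank in the whole poset,
not the rank relative to `x`. -/
def rankSet (x y : P) (i : ℕ) : Finset P := {z ∈ Icc x y | grade ℕ z = i}

theorem mem_rankSet {x y z : P} {i : ℕ} :
    z ∈ rankSet x y i ↔ x ≤ z ∧ z ≤ y ∧ grade ℕ z = i := by
  rw [rankSet, mem_filter, mem_Icc, and_assoc]

theorem rankSet_grade_left {x y : P} (hxy : x ≤ y) : rankSet x y (grade ℕ x) = {x} := by
  ext z
  rw [mem_rankSet, mem_singleton]
  constructor
  · exact fun hz => (eq_of_le_of_grade_le hz.1 hz.2.2.le).symm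
  · rintro rfl
    exact ⟨le_rfl, hxy, rfl⟩

theorem rankSet_grade_right {x y : P} (hxy : x ≤ y) : rankSet x y (grade ℕ y) = {y} := by
  ext z
  rw [mem_rankSet, mem_singleton]
  constructor
  · exact fun hz => eq_of_le_of_grade_le hz.2.1 hz.2.2.ge
  · rintro rfl
    exact ⟨hxy, le_rfl, rfl⟩

theorem atomSet_eq_rankSet (x y : P) : atomSet x y = rankSet x y (grade ℕ x + 1) := by
  ext z
  rw [mem_atomSet, mem_rankSet]
  exact ⟨fun h => ⟨h.1.le, h.2, grade_eq_add_one_of_covBy h.1⟩,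
    fun h => ⟨covBy_of_le_of_grade_eq h.1 h.2.2, h.2.1⟩⟩

theorem coatomSet_eq_rankSet {x y : P} {k : ℕ} (hk : grade ℕ y = k + 1) :
    coatomSet x y = rankSet x y k := by
  ext z
  rw [mem_coatomSet, mem_rankSet]
  constructor
  · rintro ⟨hxz, hzy⟩
    have := grade_eq_add_one_of_covBy hzy
    exact ⟨hxz, hzy.le, by omega⟩
  · exact fun h => ⟨h.1, covBy_of_le_of_grade_eq h.2.1 (by omega)⟩

theorem numMaxChains_eq_sum_rankSet {x y : P} {i : ℕ} (hxy : x ≤ y) (hxi : grade ℕ x ≤ i)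
    (hiy : i ≤ grade ℕ y) :
    numMaxChains x y = ∑ z ∈ rankSet x y i, numMaxChains x z * numMaxChains z y := by
  obtain ⟨k, hk⟩ := Nat.exists_eq_add_of_le hiy
  induction k generalizing y with
  | zero =>
    obtain rfl : grade ℕ y = i := hk
    rw [rankSet_grade_right hxy, sum_singleton, numMaxChains_self, mul_one]
  | succ k ih =>
    have ne_y {z : P} (hz : grade ℕ z ≤ i) : z ≠ y := by
      rintro rfl
      omega
    have step (w : P) (hw : w ∈ coatomSet x y) : numMaxChains x w =
        ∑ z ∈ rankSet x w i, numMaxChains x z * numMaxChains z w := by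
      obtain ⟨hxw, hwy⟩ := mem_coatomSet.1 hw
      have := grade_eq_add_one_of_covBy hwy
      exact ih hxw (by omega) (by omega)
    have expand (z : P) (hz : z ∈ rankSet x y i) : numMaxChains x z * numMaxChains z y =
        ∑ w ∈ coatomSet z y, numMaxChains x z * numMaxChains z w := by
      obtain ⟨-, hzy, hzi⟩ := mem_rankSet.1 hz
      rw [numMaxChains_eq_sum_coatomSet (hzy.lt_of_ne (ne_y hzi.le)), mul_sum]
    rw [numMaxChains_eq_sum_coatomSet (hxy.lt_of_ne (ne_y hxi)), sum_congr rfl step,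
      sum_congr rfl expand]
    refine sum_comm' fun w z => ?_
    simp only [mem_coatomSet, mem_rankSet]
    exact ⟨fun ⟨⟨_, hwy⟩, hxz, hzw, hzi⟩ => ⟨⟨hzw, hwy⟩, hxz, hzw.trans hwy.le, hzi⟩,
      fun ⟨⟨hzw, hwy⟩, hxz, _, hzi⟩ => ⟨⟨hxz.trans hzw, hwy⟩, hxz, hzw, hzi⟩⟩

theorem rankSet_nonempty {x y : P} {i : ℕ} (hxy : x ≤ y) (hxi : grade ℕ x ≤ i)
    (hiy : i ≤ grade ℕ y) : (rankSet x y i).Nonempty := by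
  by_contra hempty
  have hpos := numMaxChains_pos x y
  rw [numMaxChains_eq_sum_rankSet hxy hxi hiy, not_nonempty_iff_eq_empty.1 hempty,
    sum_empty] at hpos
  exact hpos.false

theorem numMaxChains_of_covBy {x y : P} (h : x ⋖ y) : numMaxChains x y = 1 := by
  rw [numMaxChains_eq_sum_coatomSet h.lt, coatomSet_eq_rankSet (grade_eq_add_one_of_covBy h),
    rankSet_grade_left h.le, sum_singleton, numMaxChains_self]

end RankLevels

section Euler

open Finset

variable {P : Type*} [PartialOrder P] [GradeMinOrder ℕ P] [LocallyFiniteOrder P]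

theorem IsEulerianPoset.sum_neg_one_pow_grade (hE : IsEulerianPoset P) {x y : P} (hxy : x < y) :
    ∑ z ∈ Icc x y, (-1 : ℚ) ^ grade ℕ z = 0 := by
  have card_eq : #{z ∈ Icc x y | Even (grade ℕ z)} = #{z ∈ Icc x y | ¬Even (grade ℕ z)} := by
    simpa only [← coe_Icc, ← coe_filter, Set.ncard_coe_finset, mem_coe, Nat.not_even_iff_odd]
      using hE x y hxy
  calc ∑ z ∈ Icc x y, (-1 : ℚ) ^ grade ℕ z
      = ∑ z ∈ Icc x y with Even (grade ℕ z), (1 : ℚ) +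
          ∑ z ∈ Icc x y with ¬Even (grade ℕ z), (-1 : ℚ) := by
        rw [← sum_filter_add_sum_filter_not _ fun z => Even (grade ℕ z)]
        congr 1 <;> refine sum_congr rfl fun z hz => ?_
        · exact (mem_filter.1 hz).2.neg_one_pow
        · exact (Nat.not_even_iff_odd.1 (mem_filter.1 hz).2).neg_one_pow
    _ = 0 := by rw [sum_const, sum_const, card_eq, smul_neg, add_neg_cancel]

theorem IsEulerianPoset.sum_neg_one_pow_card_rankSet (hE : IsEulerianPoset P) {x y : P} {k : ℕ}
    (hxy : x < y) (hk : grade ℕ y = grade ℕ x + k) :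
    ∑ i ∈ range (k + 1), (-1 : ℚ) ^ i * #(rankSet x y (grade ℕ x + i)) = 0 := by
  have relRank_mem : ∀ z ∈ Icc x y, grade ℕ z - grade ℕ x ∈ range (k + 1) := fun z hz => by
    have := grade_mono (𝕆 := ℕ) (mem_Icc.1 hz).2
    rw [mem_range]
    omega
  have fiber_eq (i : ℕ) :
      {z ∈ Icc x y | grade ℕ z - grade ℕ x = i} = rankSet x y (grade ℕ x + i) := by
    refine filter_congr fun z hz => ?_
    have := grade_mono (𝕆 := ℕ) (mem_Icc.1 hz).1
    omega
  have fiber_sum (i : ℕ) : ∑ z ∈ Icc x y with grade ℕ z - grade ℕ x = i, (-1 : ℚ) ^ grade ℕ z =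
      (-1) ^ grade ℕ x * ((-1) ^ i * #(rankSet x y (grade ℕ x + i))) := by
    rw [fiber_eq, sum_congr rfl fun z hz => by rw [(mem_rankSet.1 hz).2.2], sum_const,
      nsmul_eq_mul, pow_add]
    ring
  have hsum := hE.sum_neg_one_pow_grade hxy
  rw [← sum_fiberwise_of_maps_to relRank_mem, sum_congr rfl fun i _ => fiber_sum i,
    ← mul_sum] at hsum
  exact (mul_eq_zero.1 hsum).resolve_left (pow_ne_zero _ (by norm_num))

end Euler

section BooleanIntervals

open Finset Nat

variable {P : Type*} [PartialOrder P] [GradeOrder ℕ P] {v y : P}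

/-- The interval `[v, y]` has the maximal-chain counts of a Boolean lattice: each subinterval of
length `k` has `k!` maximal chains. This is all of the structure of a Boolean lattice that the
argument needs. -/
def IsBooleanInterval (v y : P) : Prop :=
  ∀ ⦃x z : P⦄, v ≤ x → x ≤ z → z ≤ y → numMaxChains x z = (grade ℕ z - grade ℕ x)!

namespace IsBooleanInterval

theorem mono (h : IsBooleanInterval v y) {x z : P} (hx : v ≤ x) (hz : z ≤ y) :
    IsBooleanInterval x z :=
  fun _ _ hx' hxz hz' => h (hx.trans hx') hxz (hz'.trans hz)

variable [LocallyFiniteOrder P]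

theorem card_coatomSet (h : IsBooleanInterval v y) (hvy : v ≤ y) :
    #(coatomSet v y) + grade ℕ v = grade ℕ y := by
  rcases hvy.eq_or_lt with rfl | hlt
  · have hempty : coatomSet v v = ∅ :=
      eq_empty_of_forall_notMem fun z hz =>
        (mem_coatomSet.1 hz).2.lt.not_ge (mem_coatomSet.1 hz).1
    rw [hempty, card_empty, zero_add]
  obtain ⟨k, hk⟩ := Nat.exists_eq_add_of_lt (grade_strictMono (𝕆 := ℕ) hlt)
  have chains_coatom : ∀ z ∈ coatomSet v y, numMaxChains v z = k ! := fun z hz => by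
    obtain ⟨hvz, hzy⟩ := mem_coatomSet.1 hz
    have := grade_eq_add_one_of_covBy hzy
    rw [h le_rfl hvz hzy.le]
    congr 1
    omega
  have hcount := numMaxChains_eq_sum_coatomSet hlt
  rw [sum_congr rfl chains_coatom, sum_const, smul_eq_mul, h le_rfl hvy le_rfl,
    show grade ℕ y - grade ℕ v = k + 1 by omega, factorial_succ] at hcount
  have := Nat.eq_of_mul_eq_mul_right k.factorial_pos hcount
  omega

theorem card_atomSet (h : IsBooleanInterval v y) (hvy : v ≤ y) :
    #(atomSet v y) + grade ℕ v = grade ℕ y := by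
  rcases hvy.eq_or_lt with rfl | hlt
  · have hempty : atomSet v v = ∅ :=
      eq_empty_of_forall_notMem fun z hz =>
        (mem_atomSet.1 hz).1.lt.not_ge (mem_atomSet.1 hz).2
    rw [hempty, card_empty, zero_add]
  obtain ⟨k, hk⟩ := Nat.exists_eq_add_of_lt (grade_strictMono (𝕆 := ℕ) hlt)
  have chains_atom : ∀ z ∈ atomSet v y, numMaxChains v z * numMaxChains z y = k ! :=
    fun z hz => by
      obtain ⟨hvz, hzy⟩ := mem_atomSet.1 hz
      have := grade_eq_add_one_of_covBy hvz
      rw [numMaxChains_of_covBy hvz, one_mul, h hvz.le hzy le_rfl]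
      congr 1
      omega
  have hcount := numMaxChains_eq_sum_rankSet hvy (Nat.le_add_right _ 1) (by omega)
  rw [← atomSet_eq_rankSet, sum_congr rfl chains_atom, sum_const, smul_eq_mul,
    h le_rfl hvy le_rfl, show grade ℕ y - grade ℕ v = k + 1 by omega, factorial_succ] at hcount
  have := Nat.eq_of_mul_eq_mul_right k.factorial_pos hcount
  omega

theorem existsUnique_coatom_not_ge (h : IsBooleanInterval v y) {u : P}
    (hu : u ∈ atomSet v y) : ∃! a, a ∈ coatomSet v y ∧ ¬u ≤ a := by
  classical
  obtain ⟨hvu, huy⟩ := mem_atomSet.1 hu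
  have hsub : coatomSet u y ⊆ coatomSet v y := fun a ha =>
    mem_coatomSet.2 ⟨hvu.le.trans (mem_coatomSet.1 ha).1, (mem_coatomSet.1 ha).2⟩
  have hcard : #(coatomSet v y \ coatomSet u y) = 1 := by
    have := h.card_coatomSet (hvu.le.trans huy)
    have := (h.mono hvu.le le_rfl).card_coatomSet huy
    have := grade_eq_add_one_of_covBy hvu
    rw [card_sdiff_of_subset hsub]
    omega
  refine (existsUnique_congr fun a => ?_).1 (card_eq_one_iff_existsUnique.1 hcard)
  rw [mem_sdiff, mem_coatomSet, mem_coatomSet]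
  tauto

theorem existsUnique_atom_not_le (h : IsBooleanInterval v y) {a : P}
    (ha : a ∈ coatomSet v y) : ∃! u, u ∈ atomSet v y ∧ ¬u ≤ a := by
  classical
  obtain ⟨hva, hay⟩ := mem_coatomSet.1 ha
  have hcard : #(atomSet v y \ atomSet v a) = 1 := by
    have := h.card_atomSet (hva.trans hay.le)
    have := (h.mono le_rfl hay.le).card_atomSet hva
    have := grade_eq_add_one_of_covBy hay
    rw [card_sdiff_of_subset (atomSet_subset_atomSet hay.le)]
    omega
  refine (existsUnique_congr fun u => ?_).1 (card_eq_one_iff_existsUnique.1 hcard)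
  rw [mem_sdiff, mem_atomSet, mem_atomSet]
  tauto

theorem le_coatom_of_atomSet_subset (h : IsBooleanInterval v y) {a z : P}
    (ha : a ∈ coatomSet v y) (hvz : v ≤ z) (hzy : z ≤ y) (hsub : atomSet v z ⊆ atomSet v a) :
    z ≤ a := by
  classical
  by_contra hza
  have insert_subset : insert a (coatomSet z y) ⊆ coatomSet v y :=
    insert_subset ha fun e he =>
      mem_coatomSet.2 ⟨hvz.trans (mem_coatomSet.1 he).1, (mem_coatomSet.1 he).2⟩
  have atoms_le : ∀ e ∈ insert a (coatomSet z y), ∀ u ∈ atomSet v z, u ≤ e := fun e he u hu => by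
    rcases mem_insert.1 he with rfl | he
    · exact (mem_atomSet.1 (hsub hu)).2
    · exact (mem_atomSet.1 hu).2.trans (mem_coatomSet.1 he).1
  have misses_atom : ∀ e ∈ insert a (coatomSet z y),
      ∃ u, u ∈ atomSet v y \ atomSet v z ∧ ¬u ≤ e := fun e he => by
    obtain ⟨u, ⟨hu, hue⟩, -⟩ := h.existsUnique_atom_not_le (insert_subset he)
    exact ⟨u, mem_sdiff.2 ⟨hu, fun huz => hue (atoms_le e he u huz)⟩, hue⟩
  have hle := card_le_card_of_forall_subsingleton (fun e u => ¬u ≤ e) misses_atom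
    fun u hu e he e' he' =>
      (h.existsUnique_coatom_not_ge (mem_sdiff.1 hu).1).unique
        ⟨insert_subset he.1, he.2⟩ ⟨insert_subset he'.1, he'.2⟩
  rw [card_insert_of_notMem fun haz => hza (mem_coatomSet.1 haz).1,
    card_sdiff_of_subset (atomSet_subset_atomSet hzy)] at hle
  have := h.card_atomSet (hvz.trans hzy)
  have := (h.mono le_rfl hzy).card_atomSet hvz
  have := (h.mono hvz le_rfl).card_coatomSet hzy
  omega

theorem existsUnique_common_lower_cover (h : IsBooleanInterval v y) {a b : P}
    (ha : a ∈ coatomSet v y) (hb : b ∈ coatomSet v y) (hab : a ≠ b) :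
    ∃! c, v ≤ c ∧ c ⋖ a ∧ c ⋖ b := by
  obtain ⟨-, hay⟩ := mem_coatomSet.1 ha
  obtain ⟨-, hby⟩ := mem_coatomSet.1 hb
  have hgrade : grade ℕ a = grade ℕ b := by
    have := grade_eq_add_one_of_covBy hay
    have := grade_eq_add_one_of_covBy hby
    omega
  obtain ⟨u, ⟨hu, hub⟩, hu_unique⟩ := h.existsUnique_atom_not_le hb
  have hua : u ∈ atomSet v a := by
    refine mem_atomSet.2 ⟨(mem_atomSet.1 hu).1, by_contra fun hua => hab ?_⟩
    exact (h.existsUnique_coatom_not_ge hu).unique ⟨ha, hua⟩ ⟨hb, hub⟩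
  obtain ⟨c, ⟨hc, huc⟩, hc_unique⟩ :=
    (h.mono le_rfl hay.le).existsUnique_coatom_not_ge hua
  obtain ⟨hvc, hca⟩ := mem_coatomSet.1 hc
  have hcb : c ≤ b := by
    refine h.le_coatom_of_atomSet_subset hb hvc (hca.le.trans hay.le) fun t ht => ?_
    obtain ⟨hvt, htc⟩ := mem_atomSet.1 ht
    refine mem_atomSet.2 ⟨hvt, by_contra fun htb => huc ?_⟩
    rwa [← hu_unique t ⟨mem_atomSet.2 ⟨hvt, htc.trans (hca.le.trans hay.le)⟩, htb⟩]
  refine ⟨c, ⟨hvc, hca, covBy_of_le_of_grade_eq hcb ?_⟩, fun c' ⟨hvc', hca', hcb'⟩ => ?_⟩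
  · rw [← hgrade, grade_eq_add_one_of_covBy hca]
  · exact hc_unique c' ⟨mem_coatomSet.2 ⟨hvc', hca'⟩, fun huc' => hub (huc'.trans hcb'.le)⟩

theorem exists_common_atom (h : IsBooleanInterval v y) (hr : grade ℕ v + 3 ≤ grade ℕ y)
    {c d : P} (hc : c ∈ coatomSet v y) (hd : d ∈ coatomSet v y) :
    ∃ u, v ⋖ u ∧ u ≤ c ∧ u ≤ d := by
  classical
  have card_atoms {e : P} (he : e ∈ coatomSet v y) :
      atomSet v e ⊆ atomSet v y ∧ #(atomSet v e) + 1 = #(atomSet v y) := by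
    obtain ⟨hve, hey⟩ := mem_coatomSet.1 he
    have := h.card_atomSet (hve.trans hey.le)
    have := (h.mono le_rfl hey.le).card_atomSet hve
    have := grade_eq_add_one_of_covBy hey
    exact ⟨atomSet_subset_atomSet hey.le, by omega⟩
  have hcard := h.card_atomSet ((mem_coatomSet.1 hc).1.trans (mem_coatomSet.1 hc).2.le)
  obtain ⟨hc_sub, hc_card⟩ := card_atoms hc
  obtain ⟨hd_sub, hd_card⟩ := card_atoms hd
  obtain ⟨u, hu⟩ := inter_nonempty_of_card_lt_card_add_card hc_sub hd_sub (by omega)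
  obtain ⟨huc, hud⟩ := mem_inter.1 hu
  exact ⟨u, (mem_atomSet.1 huc).1, (mem_atomSet.1 huc).2, (mem_atomSet.1 hud).2⟩

end IsBooleanInterval

end BooleanIntervals

section SharedAtoms

open Finset

theorem card_add_card_add_le_of_dvd_card_inter {α : Type*} [DecidableEq α] {s t e u : Finset α}
    {d : ℕ} (hs : s ⊆ u) (ht : t ⊆ u) (he : e ⊆ u) (hst : Disjoint s t) (hd : d ∣ #e)
    (hds : d ∣ #(e ∩ s)) (hdt : d ∣ #(e ∩ t)) (hsub : ¬e ⊆ s ∪ t) : #s + #t + d ≤ #u := by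
  have hcap : #(e ∩ (s ∪ t)) = #(e ∩ s) + #(e ∩ t) := by
    rw [inter_union_distrib_left, card_union_of_disjoint
      (hst.mono inter_subset_right inter_subset_right)]
  have hdvd : d ∣ #(e \ (s ∪ t)) := by
    rw [← Nat.dvd_add_right (hcap ▸ dvd_add hds hdt), card_inter_add_card_sdiff]
    exact hd
  have hpos : 0 < #(e \ (s ∪ t)) := card_pos.2 (sdiff_nonempty.2 hsub)
  calc #s + #t + d ≤ #s + #t + #(e \ (s ∪ t)) := by gcongr; exact Nat.le_of_dvd hpos hdvd
    _ = #((s ∪ t) ∪ e \ (s ∪ t)) := by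
      rw [card_union_of_disjoint disjoint_sdiff, card_union_of_disjoint hst]
    _ ≤ #u := card_le_card
      (union_subset (union_subset hs ht) (sdiff_subset.trans he))

variable {P : Type*} [PartialOrder P] {v y a b c : P}

/-- `a` and `b` lie above a common atom over `v`. -/
def SharesAtom (v a b : P) : Prop := ∃ u, v ⋖ u ∧ u ≤ a ∧ u ≤ b

theorem SharesAtom.symm (h : SharesAtom v a b) : SharesAtom v b a :=
  let ⟨u, hvu, hua, hub⟩ := h
  ⟨u, hvu, hub, hua⟩

theorem sharesAtom_of_lt_of_le [LocallyFiniteOrder P] (hvc : v < c) (hca : c ≤ a)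
    (hcb : c ≤ b) : SharesAtom v a b :=
  let ⟨u, hvu, huc⟩ := exists_covBy_le_of_lt hvc
  ⟨u, hvu, huc.trans hca, huc.trans hcb⟩

open Classical in
/-- The coatoms of `[v, y]` that share an atom over `v` with `b`. -/
noncomputable def sharingCoatoms [LocallyFiniteOrder P] (v y b : P) : Finset P :=
  {a ∈ coatomSet v y | SharesAtom v a b}

theorem mem_sharingCoatoms [LocallyFiniteOrder P] :
    a ∈ sharingCoatoms v y b ↔ a ∈ coatomSet v y ∧ SharesAtom v a b := by
  classical exact mem_filter

theorem sharingCoatoms_subset [LocallyFiniteOrder P] :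
    sharingCoatoms v y b ⊆ coatomSet v y :=
  fun _ ha => (mem_sharingCoatoms.1 ha).1

variable [GradeOrder ℕ P]

/-- All the intervals `[u, y]` with `u` an atom over `v` are Boolean, as in the face lattice of a
simple polytope. -/
def IsUpperBooleanInterval (v y : P) : Prop :=
  ∀ ⦃u : P⦄, v ⋖ u → IsBooleanInterval u y

variable [LocallyFiniteOrder P]

theorem IsBooleanInterval.eq_of_ne_of_covBy (h : IsBooleanInterval c y) (hcb : c ⋖ b)
    (hby : b ⋖ y) {a a' : P} (ha : a ∈ coatomSet c y) (ha' : a' ∈ coatomSet c y) (hab : a ≠ b)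
    (hab' : a' ≠ b) : a = a' := by
  have not_le {e : P} (he : e ∈ coatomSet c y) (hne : e ≠ b) : ¬b ≤ e := fun hbe =>
    hby.2 (hbe.lt_of_ne hne.symm) (mem_coatomSet.1 he).2.lt
  exact (h.existsUnique_coatom_not_ge (mem_atomSet.2 ⟨hcb, hby.le⟩)).unique
    ⟨ha, not_le ha hab⟩ ⟨ha', not_le ha' hab'⟩

namespace IsUpperBooleanInterval

theorem isBooleanInterval_of_lt (h : IsUpperBooleanInterval v y) (hvc : v < c) :
    IsBooleanInterval c y :=
  let ⟨_, hvu, huc⟩ := exists_covBy_le_of_lt hvc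
  (h hvu).mono huc le_rfl

theorem existsUnique_common_lower_cover (h : IsUpperBooleanInterval v y)
    (ha : a ∈ coatomSet v y) (hb : b ∈ coatomSet v y) (hab : a ≠ b) {u : P} (hvu : v ⋖ u)
    (hua : u ≤ a) (hub : u ≤ b) : ∃! c, u ≤ c ∧ c ⋖ a ∧ c ⋖ b :=
  (h hvu).existsUnique_common_lower_cover (mem_coatomSet.2 ⟨hua, (mem_coatomSet.1 ha).2⟩)
    (mem_coatomSet.2 ⟨hub, (mem_coatomSet.1 hb).2⟩) hab

theorem exists_common_lower_cover (h : IsUpperBooleanInterval v y) (ha : a ∈ coatomSet v y)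
    (hb : b ∈ coatomSet v y) (hab : a ≠ b) (hshare : SharesAtom v a b) :
    ∃ c, v < c ∧ c ⋖ a ∧ c ⋖ b := by
  obtain ⟨u, hvu, hua, hub⟩ := hshare
  obtain ⟨c, ⟨huc, hca, hcb⟩, -⟩ := h.existsUnique_common_lower_cover ha hb hab hvu hua hub
  exact ⟨c, hvu.lt.trans_le huc, hca, hcb⟩

theorem exists_other_upper_cover (h : IsUpperBooleanInterval v y) (hvc : v < c) (hcb : c ⋖ b)
    (hby : b ⋖ y) : ∃ a ∈ coatomSet v y, a ≠ b ∧ c ⋖ a := by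
  obtain ⟨a, ⟨ha, hba⟩, -⟩ := (h.isBooleanInterval_of_lt hvc).existsUnique_coatom_not_ge
    (mem_atomSet.2 ⟨hcb, hby.le⟩)
  obtain ⟨hca, hay⟩ := mem_coatomSet.1 ha
  refine ⟨a, mem_coatomSet.2 ⟨hvc.le.trans hca, hay⟩, fun hab => hba hab.ge, ?_⟩
  have := grade_eq_add_one_of_covBy hcb
  have := grade_eq_add_one_of_covBy hby
  have := grade_eq_add_one_of_covBy hay
  exact covBy_of_le_of_grade_eq hca (by omega)

theorem exists_sharesAtom (h : IsUpperBooleanInterval v y) (hvy : v ≤ y)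
    (hr : grade ℕ v + 3 ≤ grade ℕ y) :
    ∃ a ∈ coatomSet v y, ∃ b ∈ coatomSet v y, a ≠ b ∧ SharesAtom v a b := by
  obtain ⟨b, hvb, hby⟩ := exists_le_covBy_of_lt (hvy.lt_of_ne (by rintro rfl; omega))
  have := grade_eq_add_one_of_covBy hby
  obtain ⟨c, hvc, hcb⟩ := exists_le_covBy_of_lt (hvb.lt_of_ne (by rintro rfl; omega))
  have := grade_eq_add_one_of_covBy hcb
  have hvc_lt : v < c := hvc.lt_of_ne (by rintro rfl; omega)
  obtain ⟨a, ha, hab, hca⟩ := h.exists_other_upper_cover hvc_lt hcb hby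
  exact ⟨a, ha, b, mem_coatomSet.2 ⟨hvb, hby⟩, hab, sharesAtom_of_lt_of_le hvc_lt hca.le hcb.le⟩

theorem card_sharingCoatoms_le (h : IsUpperBooleanInterval v y) (hb : b ∈ coatomSet v y) :
    #(sharingCoatoms v y b) ≤ #(coatomSet v b) + 1 := by
  classical
  have exists_cover : ∀ a ∈ (sharingCoatoms v y b).erase b,
      ∃ c, c ∈ coatomSet v b ∧ v < c ∧ c ⋖ a := fun a ha => by
    obtain ⟨hab, ha⟩ := mem_erase.1 ha
    obtain ⟨ha, hshare⟩ := mem_sharingCoatoms.1 ha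
    obtain ⟨c, hvc, hca, hcb⟩ := h.exists_common_lower_cover ha hb hab hshare
    exact ⟨c, mem_coatomSet.2 ⟨hvc.le, hcb⟩, hvc, hca⟩
  have hle := card_le_card_of_forall_subsingleton (fun a c => v < c ∧ c ⋖ a) exists_cover ?_
  · have := pred_card_le_card_erase (s := sharingCoatoms v y b) (a := b)
    omega
  rintro c hc a ⟨ha, hvc, hca⟩ a' ⟨ha', -, hca'⟩
  obtain ⟨hab, ha⟩ := mem_erase.1 ha
  obtain ⟨hab', ha'⟩ := mem_erase.1 ha'
  have coatom_of_mem {e : P} (he : e ∈ sharingCoatoms v y b) (hce : c ⋖ e) :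
      e ∈ coatomSet c y :=
    mem_coatomSet.2 ⟨hce.le, (mem_coatomSet.1 (sharingCoatoms_subset he)).2⟩
  exact (h.isBooleanInterval_of_lt hvc).eq_of_ne_of_covBy (mem_coatomSet.1 hc).2
    (mem_coatomSet.1 hb).2 (coatom_of_mem ha hca) (coatom_of_mem ha' hca') hab hab'

theorem exists_disjoint_atomSet (h : IsUpperBooleanInterval v y) (hb : b ∈ coatomSet v y)
    (hcard : #(coatomSet v b) + 1 < #(coatomSet v y)) :
    ∃ b' ∈ coatomSet v y, Disjoint (atomSet v b) (atomSet v b') := by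
  obtain ⟨b', hb', hbb'⟩ := exists_mem_notMem_of_card_lt_card
    ((h.card_sharingCoatoms_le hb).trans_lt hcard)
  refine ⟨b', hb', disjoint_left.2 fun u hu hu' => hbb' ?_⟩
  obtain ⟨hvu, hub⟩ := mem_atomSet.1 hu
  exact mem_sharingCoatoms.2 ⟨hb', u, hvu, (mem_atomSet.1 hu').2, hub⟩

theorem dvd_card_atomSet_inter [DecidableEq P] (h : IsUpperBooleanInterval v y)
    (ha : a ∈ coatomSet v y) (hb : b ∈ coatomSet v y) (hab : a ≠ b) {w : ℕ}
    (hw : ∀ c, v ≤ c → c ⋖ a → c ⋖ b → #(atomSet v c) = w) :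
    w ∣ #(atomSet v a ∩ atomSet v b) := by
  have mem_common {c : P} :
      c ∈ coatomSet v a ∩ coatomSet v b ↔ v ≤ c ∧ c ⋖ a ∧ c ⋖ b := by
    rw [mem_inter, mem_coatomSet, mem_coatomSet]
    tauto
  have hunion : atomSet v a ∩ atomSet v b =
      (coatomSet v a ∩ coatomSet v b).biUnion fun c => atomSet v c := by
    ext u
    simp only [mem_biUnion, mem_common, mem_inter, mem_atomSet]
    constructor
    · rintro ⟨⟨hvu, hua⟩, -, hub⟩
      obtain ⟨c, ⟨huc, hca, hcb⟩, -⟩ := h.existsUnique_common_lower_cover ha hb hab hvu hua hub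
      exact ⟨c, ⟨hvu.le.trans huc, hca, hcb⟩, hvu, huc⟩
    · rintro ⟨c, ⟨-, hca, hcb⟩, hvu, huc⟩
      exact ⟨⟨hvu, huc.trans hca.le⟩, hvu, huc.trans hcb.le⟩
  rw [hunion, card_biUnion, sum_congr rfl fun c hc => ?_, sum_const]
  · exact Dvd.intro_left _ rfl
  · obtain ⟨hvc, hca, hcb⟩ := mem_common.1 hc
    exact hw c hvc hca hcb
  · refine fun c hc c' hc' hne => disjoint_left.2 fun u hu hu' => hne ?_
    obtain ⟨-, hca, hcb⟩ := mem_common.1 hc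
    obtain ⟨-, hca', hcb'⟩ := mem_common.1 hc'
    obtain ⟨hvu, huc⟩ := mem_atomSet.1 hu
    exact (h.existsUnique_common_lower_cover ha hb hab hvu (huc.trans hca.le)
      (huc.trans hcb.le)).unique ⟨huc, hca, hcb⟩ ⟨(mem_atomSet.1 hu').2, hca', hcb'⟩

theorem card_add_card_add_le_card_atomSet (h : IsUpperBooleanInterval v y)
    (hvy : grade ℕ v + 2 ≤ grade ℕ y) {b' : P} (hb : b ∈ coatomSet v y)
    (hb' : b' ∈ coatomSet v y) (hdisj : Disjoint (atomSet v b) (atomSet v b'))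
    (hlt : #(atomSet v b) + #(atomSet v b') < #(atomSet v y)) {d : ℕ}
    (hcoatom : ∀ a ∈ coatomSet v y, d ∣ #(atomSet v a))
    (hsub : ∀ a ∈ coatomSet v y, ∀ c, c ⋖ a → #(atomSet v c) = d) :
    #(atomSet v b) + #(atomSet v b') + d ≤ #(atomSet v y) := by
  classical
  have atoms_subset {a : P} (ha : a ∈ coatomSet v y) : atomSet v a ⊆ atomSet v y :=
    atomSet_subset_atomSet (mem_coatomSet.1 ha).2.le
  obtain ⟨u, hu, hubb'⟩ : ∃ u ∈ atomSet v y, u ∉ atomSet v b ∪ atomSet v b' :=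
    exists_mem_notMem_of_card_lt_card ((card_union_le _ _).trans_lt hlt)
  obtain ⟨hvu, huy⟩ := mem_atomSet.1 hu
  have huy_ne : u ≠ y := by
    rintro rfl
    have := grade_eq_add_one_of_covBy hvu
    omega
  obtain ⟨e, hue, hey⟩ := exists_le_covBy_of_lt (huy.lt_of_ne huy_ne)
  have he : e ∈ coatomSet v y := mem_coatomSet.2 ⟨hvu.le.trans hue, hey⟩
  have hu_mem : u ∈ atomSet v e := mem_atomSet.2 ⟨hvu, hue⟩
  have dvd_inter {a : P} (ha : a ∈ coatomSet v y) (hua : u ∉ atomSet v a) :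
      d ∣ #(atomSet v e ∩ atomSet v a) :=
    h.dvd_card_atomSet_inter he ha (fun hea => hua (hea ▸ hu_mem)) fun c _ hce _ => hsub e he c hce
  rw [mem_union, not_or] at hubb'
  exact card_add_card_add_le_of_dvd_card_inter (atoms_subset hb) (atoms_subset hb')
    (atoms_subset he) hdisj (hcoatom e he) (dvd_inter hb hubb'.1) (dvd_inter hb' hubb'.2)
    fun hle => (mem_union.1 (hle hu_mem)).elim hubb'.1 hubb'.2

theorem sharesAtom_trans (h : IsUpperBooleanInterval v y) (hvb : IsBooleanInterval v b)
    (hr : grade ℕ v + 3 ≤ grade ℕ b) {a a' : P} (ha : a ∈ coatomSet v y)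
    (hb : b ∈ coatomSet v y) (ha' : a' ∈ coatomSet v y) (hab : SharesAtom v a b)
    (hba' : SharesAtom v b a') : SharesAtom v a a' := by
  rcases eq_or_ne a b with rfl | hne
  · exact hba'
  rcases eq_or_ne b a' with rfl | hne'
  · exact hab
  obtain ⟨c, hvc, hca, hcb⟩ := h.exists_common_lower_cover ha hb hne hab
  obtain ⟨d, hvd, hdb, hda'⟩ := h.exists_common_lower_cover hb ha' hne' hba'
  obtain ⟨u, hvu, huc, hud⟩ := hvb.exists_common_atom hr (mem_coatomSet.2 ⟨hvc.le, hcb⟩)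
    (mem_coatomSet.2 ⟨hvd.le, hdb⟩)
  exact ⟨u, hvu, huc.trans hca.le, hud.trans hda'.le⟩

theorem le_card_sharingCoatoms (h : IsUpperBooleanInterval v y) (hvb : IsBooleanInterval v b)
    (hr : grade ℕ v + 3 ≤ grade ℕ b) (hb : b ∈ coatomSet v y) :
    #(coatomSet v b) + 1 ≤ #(sharingCoatoms v y b) := by
  classical
  have hvb_lt : v < b := (mem_coatomSet.1 hb).1.lt_of_ne (by rintro rfl; omega)
  have hby := (mem_coatomSet.1 hb).2
  have hb_mem : b ∈ sharingCoatoms v y b :=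
    mem_sharingCoatoms.2 ⟨hb, sharesAtom_of_lt_of_le hvb_lt le_rfl le_rfl⟩
  have lt_of_mem {d : P} (hd : d ∈ coatomSet v b) : v < d := by
    obtain ⟨hvd, hdb⟩ := mem_coatomSet.1 hd
    have := grade_eq_add_one_of_covBy hdb
    exact hvd.lt_of_ne (by rintro rfl; omega)
  have exists_above : ∀ d ∈ coatomSet v b,
      ∃ a, a ∈ (sharingCoatoms v y b).erase b ∧ d ⋖ a := fun d hd => by
    have hvd := lt_of_mem hd
    have hdb := (mem_coatomSet.1 hd).2
    obtain ⟨a, ha, hab, hda⟩ := h.exists_other_upper_cover hvd hdb hby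
    exact ⟨a, mem_erase.2 ⟨hab, mem_sharingCoatoms.2
      ⟨ha, sharesAtom_of_lt_of_le hvd hda.le hdb.le⟩⟩, hda⟩
  have hle := card_le_card_of_forall_subsingleton (fun d a => d ⋖ a) exists_above ?_
  · rw [← card_erase_add_one hb_mem]
    omega
  rintro a ha d ⟨hd, hda⟩ d' ⟨hd', hda'⟩
  obtain ⟨hab, ha⟩ := mem_erase.1 ha
  obtain ⟨u, hvu, hud, hud'⟩ := hvb.exists_common_atom hr hd hd'
  have hdb := (mem_coatomSet.1 hd).2
  have hdb' := (mem_coatomSet.1 hd').2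
  exact (h.existsUnique_common_lower_cover (sharingCoatoms_subset ha) hb hab hvu
    (hud.trans hda.le) (hud.trans hdb.le)).unique ⟨hud, hda, hdb⟩ ⟨hud', hda', hdb'⟩

theorem card_coatomSet_eq_or_two_mul_le (h : IsUpperBooleanInterval v y) {k : ℕ}
    (hk : grade ℕ y = grade ℕ v + k) (hk4 : 4 ≤ k) (hvy : v ≤ y)
    (hlower : ∀ a ∈ coatomSet v y, IsBooleanInterval v a) :
    #(coatomSet v y) = k ∨ 2 * k ≤ #(coatomSet v y) := by
  classical
  have grade_coatom {b : P} (hb : b ∈ coatomSet v y) : grade ℕ v + 3 ≤ grade ℕ b := by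
    have := grade_eq_add_one_of_covBy (mem_coatomSet.1 hb).2
    omega
  have card_class {b : P} (hb : b ∈ coatomSet v y) : #(sharingCoatoms v y b) = k := by
    have := h.card_sharingCoatoms_le hb
    have := h.le_card_sharingCoatoms (hlower b hb) (grade_coatom hb) hb
    have := (hlower b hb).card_coatomSet (mem_coatomSet.1 hb).1
    have := grade_eq_add_one_of_covBy (mem_coatomSet.1 hb).2
    omega
  have hvy_lt : v < y := hvy.lt_of_ne (by rintro rfl; omega)
  obtain ⟨b, hvb, hby⟩ := exists_le_covBy_of_lt hvy_lt
  have hb := mem_coatomSet.2 ⟨hvb, hby⟩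
  by_cases hall : coatomSet v y ⊆ sharingCoatoms v y b
  · exact Or.inl ((congrArg card (sharingCoatoms_subset.antisymm hall)).symm.trans
      (card_class hb))
  obtain ⟨b', hb', hbb'⟩ := not_subset.1 hall
  have hdisj : Disjoint (sharingCoatoms v y b) (sharingCoatoms v y b') :=
    disjoint_left.2 fun a ha ha' => hbb' <| mem_sharingCoatoms.2 ⟨hb', by
      obtain ⟨ha, hab⟩ := mem_sharingCoatoms.1 ha
      obtain ⟨-, hab'⟩ := mem_sharingCoatoms.1 ha'
      exact h.sharesAtom_trans (hlower a ha) (grade_coatom ha) hb' ha hb hab'.symm hab⟩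
  have := card_le_card (union_subset (sharingCoatoms_subset (b := b) (v := v) (y := y))
    (sharingCoatoms_subset (b := b')))
  rw [card_union_of_disjoint hdisj, card_class hb, card_class hb'] at this
  omega

end IsUpperBooleanInterval

end SharedAtoms

section AlternatingConvolutions

open Finset Nat

theorem sum_neg_one_pow_mul_inv_factorial {k : ℕ} (hk : k ≠ 0) :
    ∑ i ∈ range (k + 1), (-1 : ℚ) ^ i * (1 / (i ! : ℚ) * (1 / ((k - i)! : ℚ))) = 0 := by
  have hbinom : ∑ i ∈ range (k + 1), (-1 : ℚ) ^ i * 1 ^ (k - i) * k.choose i = 0 := by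
    rw [← add_pow, neg_add_cancel, zero_pow hk]
  rw [← zero_div (k ! : ℚ), ← hbinom, sum_div]
  refine sum_congr rfl fun i hi => ?_
  rw [Nat.cast_choose ℚ (mem_range_succ_iff.1 hi), one_pow]
  field

theorem sum_neg_one_pow_mul_inv_two_pow_factorial (k : ℕ) :
    1 / (2 ^ k * k ! : ℚ) + ∑ i ∈ range (k + 1),
      (-1 : ℚ) ^ (i + 1) * (1 / (2 ^ i * i ! : ℚ) * (1 / ((k - i)! : ℚ))) = 0 := by
  have hbinom : ∑ i ∈ range (k + 1), (-(1 / 2) : ℚ) ^ i * 1 ^ (k - i) * k.choose i =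
      (1 / 2) ^ k := by
    rw [← add_pow]
    norm_num
  have hterm : ∀ i ∈ range (k + 1),
      (-1 : ℚ) ^ (i + 1) * (1 / (2 ^ i * i ! : ℚ) * (1 / ((k - i)! : ℚ))) =
        -((-(1 / 2) : ℚ) ^ i * 1 ^ (k - i) * k.choose i / k !) := fun i hi => by
    rw [Nat.cast_choose ℚ (mem_range_succ_iff.1 hi), neg_pow (1 / 2 : ℚ), one_div_pow, one_pow]
    field
  rw [sum_congr rfl hterm, sum_neg_distrib, ← sum_div, hbinom, one_div_pow]
  field

/-- With `f 0 = 1` and `k` even, both end terms of the convolution are `f k`. -/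
theorem eq_of_alternating_self_convolution_eq {f g : ℕ → ℚ} {k : ℕ} (hk : Even k) (hk0 : k ≠ 0)
    (hfg : ∀ i < k, f i = g i) (hg0 : g 0 = 1)
    (hsum : ∑ i ∈ range (k + 1), (-1 : ℚ) ^ i * (f i * f (k - i)) =
      ∑ i ∈ range (k + 1), (-1 : ℚ) ^ i * (g i * g (k - i))) : f k = g k := by
  obtain ⟨l, rfl⟩ := Nat.exists_eq_add_one_of_ne_zero hk0
  have hmid : ∀ i ∈ range l, (-1 : ℚ) ^ (i + 1) * (f (i + 1) * f (l + 1 - (i + 1))) =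
      (-1) ^ (i + 1) * (g (i + 1) * g (l + 1 - (i + 1))) := fun i hi => by
    rw [mem_range] at hi
    rw [hfg (i + 1) (by omega), hfg (l + 1 - (i + 1)) (by omega)]
  have hf0 : f 0 = 1 := (hfg 0 (by omega)).trans hg0
  rw [sum_range_succ, sum_range_succ', sum_range_succ, sum_range_succ', sum_congr rfl hmid] at hsum
  simp only [hk.neg_one_pow, pow_zero, Nat.sub_zero, Nat.sub_self, hf0, hg0] at hsum
  linarith

theorem two_mul_sub_eq_of_alternating_convolution_eq {f F h H : ℕ → ℚ} {k : ℕ} (hk : Even k)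
    (hk0 : k ≠ 0) (hf : ∀ i ≤ k, f i = F i) (hh : ∀ i < k, h i = H i) (hF0 : F 0 = 1)
    (hF1 : F 1 = 1) (hH0 : H 0 = 1)
    (hsum : h (k + 1) + ∑ i ∈ range (k + 2), (-1 : ℚ) ^ (i + 1) * (h i * f (k + 1 - i)) =
      H (k + 1) + ∑ i ∈ range (k + 2), (-1 : ℚ) ^ (i + 1) * (H i * F (k + 1 - i))) :
    2 * (h (k + 1) - H (k + 1)) = (f (k + 1) - F (k + 1)) + (h k - H k) := by
  obtain ⟨l, rfl⟩ := Nat.exists_eq_add_one_of_ne_zero hk0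
  have hmid : ∀ i ∈ range l, (-1 : ℚ) ^ (i + 1 + 1) * (h (i + 1) * f (l + 2 - (i + 1))) =
      (-1) ^ (i + 1 + 1) * (H (i + 1) * F (l + 2 - (i + 1))) := fun i hi => by
    rw [mem_range] at hi
    rw [hf (l + 2 - (i + 1)) (by omega), hh (i + 1) (by omega)]
  have hf0 : f 0 = 1 := (hf 0 (by omega)).trans hF0
  have hf1 : f 1 = 1 := (hf 1 (by omega)).trans hF1
  have hh0 : h 0 = 1 := (hh 0 (by omega)).trans hH0
  rw [sum_range_succ, sum_range_succ, sum_range_succ', sum_range_succ, sum_range_succ,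
    sum_range_succ', sum_congr rfl hmid] at hsum
  simp only [pow_succ _ (l + 1), pow_succ _ (l + 1 + 1), hk.neg_one_pow, zero_add,
    Nat.sub_zero, Nat.sub_self, Nat.add_sub_cancel_left, hf0, hf1, hF0, hF1, hh0, hH0] at hsum
  linarith

end AlternatingConvolutions

section ShefferCounts

open Finset Nat

variable {P : Type*} [PartialOrder P] [BoundedOrder P] [GradeMinOrder ℕ P] {B D : ℕ → ℕ}
  {x y : P}

theorem grade_bot_eq_zero : grade ℕ (⊥ : P) = 0 :=
  grade_bot.trans bot_eq_zero

theorem ne_bot_of_grade_ne_zero (hx : grade ℕ x ≠ 0) : x ≠ ⊥ := by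
  rintro rfl
  exact hx grade_bot_eq_zero

theorem grade_le_grade_top (x : P) : grade ℕ x ≤ grade ℕ (⊤ : P) :=
  grade_mono le_top

namespace IsShefferPoset

theorem numMaxChains_bot (hS : IsShefferPoset P B D) {k : ℕ} (hk : grade ℕ y = k) :
    numMaxChains ⊥ y = D k :=
  hk ▸ hS.sheffer_interval y

theorem numMaxChains_of_ne_bot (hS : IsShefferPoset P B D) (hx : x ≠ ⊥) (hxy : x ≤ y) {k : ℕ}
    (hk : grade ℕ y = grade ℕ x + k) : numMaxChains x y = B k := by
  rw [hS.binomial_interval x y hx hxy, hk, Nat.add_sub_cancel_left]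

theorem sheffer_zero (hS : IsShefferPoset P B D) : D 0 = 1 := by
  rw [← hS.numMaxChains_bot grade_bot_eq_zero, numMaxChains_self]

end IsShefferPoset

variable [LocallyFiniteOrder P]

theorem exists_grade_eq {i : ℕ} (hi : i ≤ grade ℕ (⊤ : P)) : ∃ y : P, grade ℕ y = i :=
  let ⟨y, hy⟩ := rankSet_nonempty (x := (⊥ : P)) bot_le (by simp) hi
  ⟨y, (mem_rankSet.1 hy).2.2⟩

theorem exists_interval_above_bot {k : ℕ} (hk : k < grade ℕ (⊤ : P)) :
    ∃ x y : P, x ≠ ⊥ ∧ x ≤ y ∧ grade ℕ y = grade ℕ x + k := by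
  obtain ⟨x, hx⟩ := exists_grade_eq (P := P) (i := 1) (by omega)
  obtain ⟨y, hy⟩ := rankSet_nonempty (x := x) (y := ⊤) (i := 1 + k) le_top (by omega) (by omega)
  obtain ⟨hxy, -, hyk⟩ := mem_rankSet.1 hy
  exact ⟨x, y, ne_bot_of_grade_ne_zero (by omega), hxy, by omega⟩

namespace IsShefferPoset

theorem card_rankSet_mul (hS : IsShefferPoset P B D) (hx : x ≠ ⊥) (hxy : x ≤ y) {i k : ℕ}
    (hk : grade ℕ y = grade ℕ x + k) (hi : i ≤ k) :
    #(rankSet x y (grade ℕ x + i)) * (B i * B (k - i)) = B k := by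
  have hchains : ∀ z ∈ rankSet x y (grade ℕ x + i),
      numMaxChains x z * numMaxChains z y = B i * B (k - i) := fun z hz => by
    obtain ⟨hxz, hzy, hzi⟩ := mem_rankSet.1 hz
    rw [hS.numMaxChains_of_ne_bot hx hxz hzi, hS.numMaxChains_of_ne_bot (k := k - i)
      (ne_bot_of_le_ne_bot hx hxz) hzy (by omega)]
  rw [← hS.numMaxChains_of_ne_bot hx hxy hk,
    numMaxChains_eq_sum_rankSet hxy (Nat.le_add_right _ i) (by omega), sum_congr rfl hchains,
    sum_const, smul_eq_mul]

theorem card_rankSet_bot_mul (hS : IsShefferPoset P B D) {i k : ℕ} (hk : grade ℕ y = k)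
    (hi : i < k) : #(rankSet ⊥ y (i + 1)) * (D (i + 1) * B (k - (i + 1))) = D k := by
  have hchains : ∀ z ∈ rankSet ⊥ y (i + 1),
      numMaxChains ⊥ z * numMaxChains z y = D (i + 1) * B (k - (i + 1)) := fun z hz => by
    obtain ⟨-, hzy, hzi⟩ := mem_rankSet.1 hz
    rw [hS.numMaxChains_bot hzi, hS.numMaxChains_of_ne_bot (k := k - (i + 1))
      (ne_bot_of_grade_ne_zero (by omega)) hzy (by omega)]
  rw [← hS.numMaxChains_bot hk, numMaxChains_eq_sum_rankSet (i := i + 1) bot_le (by simp)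
    (by omega), sum_congr rfl hchains, sum_const, smul_eq_mul]

theorem binomial_pos (hS : IsShefferPoset P B D) {k : ℕ} (hk : k < grade ℕ (⊤ : P)) :
    0 < B k := by
  obtain ⟨x, y, hx, hxy, hxyk⟩ := exists_interval_above_bot hk
  exact hS.numMaxChains_of_ne_bot hx hxy hxyk ▸ numMaxChains_pos x y

theorem sheffer_pos (hS : IsShefferPoset P B D) {k : ℕ} (hk : k ≤ grade ℕ (⊤ : P)) :
    0 < D k := by
  obtain ⟨y, hy⟩ := exists_grade_eq hk
  exact hS.numMaxChains_bot hy ▸ numMaxChains_pos ⊥ y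

theorem binomial_zero (hS : IsShefferPoset P B D) (hk : 0 < grade ℕ (⊤ : P)) : B 0 = 1 := by
  obtain ⟨x, hx⟩ := exists_grade_eq (P := P) (i := 1) hk
  rw [← hS.numMaxChains_of_ne_bot (ne_bot_of_grade_ne_zero (by omega)) (le_refl x) rfl,
    numMaxChains_self]

theorem binomial_one (hS : IsShefferPoset P B D) (hk : 1 < grade ℕ (⊤ : P)) : B 1 = 1 := by
  obtain ⟨x, y, hx, hxy, hxyk⟩ := exists_interval_above_bot hk
  rw [← hS.numMaxChains_of_ne_bot hx hxy hxyk,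
    numMaxChains_of_covBy (covBy_of_le_of_grade_eq hxy hxyk)]

theorem sheffer_one (hS : IsShefferPoset P B D) (hk : 0 < grade ℕ (⊤ : P)) : D 1 = 1 := by
  obtain ⟨y, hy⟩ := exists_grade_eq (P := P) (i := 1) hk
  rw [← hS.numMaxChains_bot hy,
    numMaxChains_of_covBy (covBy_of_le_of_grade_eq bot_le (by rw [hy, grade_bot_eq_zero]))]

theorem card_atomSet_bot_mul (hS : IsShefferPoset P B D) {k : ℕ} (hk : grade ℕ y = k + 1) :
    #(atomSet ⊥ y) * B k = D (k + 1) := by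
  have := grade_le_grade_top y
  rw [← hS.card_rankSet_bot_mul hk k.succ_pos, hS.sheffer_one (by omega), one_mul,
    Nat.add_sub_cancel, atomSet_eq_rankSet, grade_bot_eq_zero]

theorem card_coatomSet_bot_mul (hS : IsShefferPoset P B D) {k : ℕ} (hk : grade ℕ y = k + 2) :
    #(coatomSet ⊥ y) * D (k + 1) = D (k + 2) := by
  have := grade_le_grade_top y
  rw [← hS.card_rankSet_bot_mul hk (by omega : k < k + 2), coatomSet_eq_rankSet hk,
    show k + 2 - (k + 1) = 1 by omega, hS.binomial_one (by omega), mul_one]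

theorem card_coatomSet_mul (hS : IsShefferPoset P B D) (hx : x ≠ ⊥) (hxy : x ≤ y) {k : ℕ}
    (hk : grade ℕ y = grade ℕ x + (k + 1)) : #(coatomSet x y) * B k = B (k + 1) := by
  have hx0 : grade ℕ x ≠ 0 := fun h => hx <|
    (eq_of_le_of_grade_le bot_le (h.trans grade_bot_eq_zero.symm).le).symm
  have := grade_le_grade_top y
  rw [← hS.card_rankSet_mul hx hxy hk k.le_succ, coatomSet_eq_rankSet (k := grade ℕ x + k) hk,
    Nat.add_sub_cancel_left, hS.binomial_one (by omega), mul_one]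

end IsShefferPoset

end ShefferCounts

section FactorialFunctions

open Finset Nat

/-- The values of `B` at `0, …, k` are those of the binomial factorial function of a Boolean
lattice, or of a cubical lattice. -/
def IsFactorialUpTo (B : ℕ → ℕ) (k : ℕ) : Prop := ∀ i ≤ k, B i = i !

/-- The values of `D` at `1, …, k` are those of the Sheffer factorial function of a cubical
lattice; the index is shifted to avoid a truncated subtraction. -/
def IsCubicalUpTo (D : ℕ → ℕ) (k : ℕ) : Prop := ∀ i < k, D (i + 1) = 2 ^ i * i !

variable {B D : ℕ → ℕ} {k : ℕ}

theorem IsFactorialUpTo.succ (h : IsFactorialUpTo B k) (hk : B (k + 1) = (k + 1)!) :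
    IsFactorialUpTo B (k + 1) := fun i hi => by
  rcases Nat.le_succ_iff.1 hi with hi | rfl
  · exact h i hi
  · exact hk

theorem IsCubicalUpTo.succ (h : IsCubicalUpTo D k) (hk : D (k + 1) = 2 ^ k * k !) :
    IsCubicalUpTo D (k + 1) := fun i hi => by
  rcases Nat.lt_succ_iff_lt_or_eq.1 hi with hi | rfl
  · exact h i hi
  · exact hk

variable {P : Type*} [PartialOrder P] [BoundedOrder P] [GradeMinOrder ℕ P] {x y : P}

namespace IsShefferPoset

theorem isBooleanInterval (hS : IsShefferPoset P B D) (hB : IsFactorialUpTo B k) (hx : x ≠ ⊥)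
    (hy : grade ℕ y ≤ grade ℕ x + k) : IsBooleanInterval x y := fun a b hxa hab hby => by
  have := grade_mono (𝕆 := ℕ) hxa
  have := grade_mono (𝕆 := ℕ) hby
  rw [hS.binomial_interval a b (ne_bot_of_le_ne_bot hx hxa) hab, hB _ (by omega)]

theorem isUpperBooleanInterval (hS : IsShefferPoset P B D) (hB : IsFactorialUpTo B k)
    (hy : grade ℕ y ≤ grade ℕ x + (k + 1)) : IsUpperBooleanInterval x y := fun u hxu => by
  have := grade_eq_add_one_of_covBy hxu
  exact hS.isBooleanInterval hB (bot_le.trans_lt hxu.lt).ne' (by omega)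

variable [LocallyFiniteOrder P]

theorem card_atomSet_bot (hS : IsShefferPoset P B D) (hy : grade ℕ y = k + 1) (hB : B k = k !)
    (hD : D (k + 1) = 2 ^ k * k !) : #(atomSet ⊥ y) = 2 ^ k := by
  have hcount := hS.card_atomSet_bot_mul hy
  rw [hB, hD] at hcount
  exact Nat.eq_of_mul_eq_mul_right k.factorial_pos hcount

theorem sum_binomial (hS : IsShefferPoset P B D) (hE : IsEulerianPoset P) (hk0 : k ≠ 0)
    (hk : k < grade ℕ (⊤ : P)) :
    ∑ i ∈ range (k + 1), (-1 : ℚ) ^ i * (1 / (B i : ℚ) * (1 / (B (k - i) : ℚ))) = 0 := by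
  obtain ⟨x, y, hx, hxy, hyk⟩ := exists_interval_above_bot hk
  have hBk : (B k : ℚ) ≠ 0 := mod_cast (hS.binomial_pos hk).ne'
  have hterm : ∀ i ∈ range (k + 1), (-1 : ℚ) ^ i * #(rankSet x y (grade ℕ x + i)) =
      B k * ((-1) ^ i * (1 / (B i : ℚ) * (1 / (B (k - i) : ℚ)))) := fun i hi => by
    rw [mem_range] at hi
    have := (hS.binomial_pos (k := i) (by omega)).ne'
    have := (hS.binomial_pos (k := k - i) (by omega)).ne'
    rw [← hS.card_rankSet_mul hx hxy hyk (i := i) (by omega)]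
    push_cast
    field
  have hsum := hE.sum_neg_one_pow_card_rankSet (hxy.lt_of_ne (by rintro rfl; omega)) hyk
  rw [sum_congr rfl hterm, ← mul_sum] at hsum
  exact (mul_eq_zero.1 hsum).resolve_left hBk

theorem sum_sheffer (hS : IsShefferPoset P B D) (hE : IsEulerianPoset P)
    (hk : k < grade ℕ (⊤ : P)) :
    1 / (D (k + 1) : ℚ) + ∑ i ∈ range (k + 1),
      (-1 : ℚ) ^ (i + 1) * (1 / (D (i + 1) : ℚ) * (1 / (B (k - i) : ℚ))) = 0 := by
  obtain ⟨y, hy⟩ := exists_grade_eq (P := P) (i := k + 1) hk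
  have hDk : (D (k + 1) : ℚ) ≠ 0 := mod_cast (hS.sheffer_pos hk).ne'
  have hterm : ∀ i ∈ range (k + 1), (-1 : ℚ) ^ (i + 1) * #(rankSet ⊥ y (i + 1)) =
      D (k + 1) * ((-1) ^ (i + 1) * (1 / (D (i + 1) : ℚ) * (1 / (B (k - i) : ℚ)))) :=
    fun i hi => by
      rw [mem_range] at hi
      have := (hS.sheffer_pos (k := i + 1) (by omega)).ne'
      have := (hS.binomial_pos (k := k - i) (by omega)).ne'
      rw [← hS.card_rankSet_bot_mul hy hi, Nat.add_sub_add_right]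
      push_cast
      field
  have hbot : ⊥ < y := (ne_bot_of_grade_ne_zero (by omega)).bot_lt
  have hsum := hE.sum_neg_one_pow_card_rankSet (k := k + 1) hbot
    (by rw [hy, grade_bot_eq_zero, zero_add])
  rw [sum_range_succ', add_zero, rankSet_grade_left bot_le, grade_bot_eq_zero] at hsum
  simp only [zero_add, pow_zero, card_singleton, Nat.cast_one, mul_one] at hsum
  rw [sum_congr rfl hterm, ← mul_sum] at hsum
  refine mul_left_cancel₀ hDk ?_
  rw [mul_add, mul_one_div_cancel hDk, add_comm, hsum, mul_zero]

theorem binomial_succ_eq_factorial_of_odd (hS : IsShefferPoset P B D) (hE : IsEulerianPoset P)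
    (hk : Odd k) (hkt : k + 1 < grade ℕ (⊤ : P)) (hB : IsFactorialUpTo B k) :
    B (k + 1) = (k + 1)! := by
  have hinv : 1 / (B (k + 1) : ℚ) = 1 / ((k + 1)! : ℚ) :=
    eq_of_alternating_self_convolution_eq (f := fun i => 1 / (B i : ℚ))
      (g := fun i => 1 / (i ! : ℚ)) hk.add_one k.succ_ne_zero
      (fun i hi => by rw [hB i (Nat.le_of_lt_succ hi)]) (by norm_num)
      ((hS.sum_binomial hE k.succ_ne_zero hkt).trans
        (sum_neg_one_pow_mul_inv_factorial k.succ_ne_zero).symm)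
  rwa [one_div, one_div, inv_inj, Nat.cast_inj] at hinv

theorem sheffer_two (hS : IsShefferPoset P B D) (hE : IsEulerianPoset P)
    (htop : 2 ≤ grade ℕ (⊤ : P)) : D 2 = 2 := by
  have hsum := hS.sum_sheffer hE (k := 1) htop
  rw [sum_range_succ, sum_range_one, zero_add, tsub_zero, tsub_self, one_add_one_eq_two,
    hS.sheffer_one (by omega), hS.binomial_one htop, hS.binomial_zero (by omega),
    Nat.cast_one] at hsum
  have hinv : 1 / (D 2 : ℚ) = 1 / 2 := by linarith
  rw [one_div, one_div, inv_inj] at hinv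
  exact_mod_cast hinv

theorem two_mul_inv_sheffer_sub (hS : IsShefferPoset P B D) (hE : IsEulerianPoset P)
    (hk : Even k) (hk0 : k ≠ 0) (htop : k + 2 ≤ grade ℕ (⊤ : P)) (hB : IsFactorialUpTo B k)
    (hD : IsCubicalUpTo D k) :
    2 * (1 / (D (k + 2) : ℚ) - 1 / (2 ^ (k + 1) * (k + 1)!)) =
      (1 / (B (k + 1) : ℚ) - 1 / ((k + 1)! : ℚ)) +
        (1 / (D (k + 1) : ℚ) - 1 / (2 ^ k * k !)) :=
  two_mul_sub_eq_of_alternating_convolution_eq (f := fun i => 1 / (B i : ℚ))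
    (F := fun i => 1 / (i ! : ℚ)) (h := fun i => 1 / (D (i + 1) : ℚ))
    (H := fun i => 1 / (2 ^ i * i ! : ℚ)) hk hk0 (fun i hi => by rw [hB i hi])
    (fun i hi => by rw [hD i hi]; push_cast; rfl) (by norm_num) (by norm_num) (by norm_num)
    ((hS.sum_sheffer hE (k := k + 1) htop).trans
      (sum_neg_one_pow_mul_inv_two_pow_factorial (k + 1)).symm)

theorem isCubicalUpTo_succ (hS : IsShefferPoset P B D) (hE : IsEulerianPoset P) (hk : Even k)
    (hk0 : k ≠ 0) (htop : k + 2 ≤ grade ℕ (⊤ : P)) (hB : IsFactorialUpTo B (k + 1))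
    (hD : IsCubicalUpTo D (k + 1)) : IsCubicalUpTo D (k + 2) := by
  refine hD.succ ?_
  have hrel := hS.two_mul_inv_sheffer_sub hE hk hk0 htop (fun i hi => hB i (by omega))
    fun i hi => hD i (by omega)
  have hDk : (D (k + 1) : ℚ) = 2 ^ k * k ! := mod_cast hD k k.lt_succ_self
  rw [hB (k + 1) le_rfl, hDk, sub_self, sub_self, add_zero] at hrel
  have hinv := sub_eq_zero.1 ((mul_eq_zero.1 hrel).resolve_left two_ne_zero)
  rw [one_div, one_div, inv_inj] at hinv
  exact_mod_cast hinv

end IsShefferPoset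

end FactorialFunctions

section InductiveStep

open Finset Nat

variable {P : Type*} [PartialOrder P] [BoundedOrder P] [GradeMinOrder ℕ P]
  [LocallyFiniteOrder P] {B D : ℕ → ℕ} {k : ℕ} {y z : P}

namespace IsShefferPoset

theorem binomial_eq_factorial_or_two_mul_le (hS : IsShefferPoset P B D) (hk : 3 ≤ k)
    (hkt : k + 1 < grade ℕ (⊤ : P)) (hB : IsFactorialUpTo B k) :
    B (k + 1) = (k + 1)! ∨ 2 * (k + 1)! ≤ B (k + 1) := by
  obtain ⟨x, y, hx, hxy, hxyk⟩ := exists_interval_above_bot hkt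
  have hlower : ∀ a ∈ coatomSet x y, IsBooleanInterval x a := fun a ha => by
    have := grade_eq_add_one_of_covBy (mem_coatomSet.1 ha).2
    exact hS.isBooleanInterval hB hx (by omega)
  rw [← hS.card_coatomSet_mul hx hxy hxyk, hB k le_rfl, factorial_succ, ← mul_assoc]
  rcases (hS.isUpperBooleanInterval hB hxyk.le).card_coatomSet_eq_or_two_mul_le hxyk (by omega)
    hxy hlower with hcard | hcard
  · exact Or.inl (by rw [hcard])
  · exact Or.inr (Nat.mul_le_mul_right _ hcard)

theorem two_pow_mul_factorial_le_sheffer (hS : IsShefferPoset P B D)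
    (hkt : k + 2 ≤ grade ℕ (⊤ : P)) (hB : IsFactorialUpTo B (k + 1))
    (hD : IsCubicalUpTo D (k + 1)) : 2 ^ k * (k + 1)! ≤ D (k + 2) := by
  obtain ⟨y, hy⟩ := exists_grade_eq hkt
  obtain ⟨b, hb⟩ := rankSet_nonempty (x := (⊥ : P)) (i := k + 1) (y := y) bot_le (by simp)
    (by omega)
  obtain ⟨-, hby, hbk⟩ := mem_rankSet.1 hb
  rw [← hS.card_atomSet_bot_mul hy, hB (k + 1) le_rfl,
    ← hS.card_atomSet_bot hbk (hB k k.le_succ) (hD k k.lt_succ_self)]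
  exact Nat.mul_le_mul_right _ (card_le_card (atomSet_subset_atomSet hby))

theorem binomial_add_two_eq_factorial (hS : IsShefferPoset P B D) (hE : IsEulerianPoset P)
    (hk : Odd k) (hk3 : 3 ≤ k) (htop : k + 3 ≤ grade ℕ (⊤ : P)) (hB : IsFactorialUpTo B (k + 1))
    (hD : IsCubicalUpTo D (k + 1)) : B (k + 2) = (k + 2)! := by
  refine (hS.binomial_eq_factorial_or_two_mul_le (by omega) (by omega) hB).resolve_right
    fun hlarge => ?_
  have hrel := hS.two_mul_inv_sheffer_sub hE hk.add_one k.succ_ne_zero htop hB hD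
  have hpos : (0 : ℚ) < 1 / D (k + 3) := one_div_pos.2 (mod_cast hS.sheffer_pos htop)
  have hbinom : 1 / (B (k + 2) : ℚ) ≤ 1 / (2 * (k + 2)!) :=
    one_div_le_one_div_of_le (by positivity) (mod_cast hlarge)
  have hsheffer : 1 / (D (k + 2) : ℚ) ≤ 1 / (2 ^ k * (k + 1)!) :=
    one_div_le_one_div_of_le (by positivity)
      (mod_cast hS.two_pow_mul_factorial_le_sheffer (by omega) hB hD)
  have hpow : (k + 3 : ℚ) ≤ 2 ^ k := by
    have : ∀ j, 3 ≤ j → j + 3 ≤ 2 ^ j := fun j hj => by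
      induction j, hj using Nat.le_induction with
      | base => norm_num
      | succ j _ ih => rw [pow_succ]; omega
    exact_mod_cast this k hk3
  have hupper : 1 / (2 * (k + 2)! : ℚ) - 1 / (k + 2)! + (1 / (2 ^ k * (k + 1)!) -
      1 / (2 ^ (k + 1) * (k + 1)!)) + 2 * (1 / (2 ^ (k + 2) * (k + 2)!)) =
        (k + 3 - 2 ^ k) / (2 ^ (k + 1) * (k + 2)!) := by
    rw [factorial_succ (k + 1)]
    push_cast
    field
  have : (k + 3 - 2 ^ k : ℚ) / (2 ^ (k + 1) * (k + 2)!) ≤ 0 :=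
    div_nonpos_of_nonpos_of_nonneg (by linarith) (by positivity)
  linarith

theorem card_coatomSet_bot (hS : IsShefferPoset P B D) (hy : grade ℕ y = k + 2)
    (hD : IsCubicalUpTo D (k + 2)) : #(coatomSet ⊥ y) = 2 * (k + 1) := by
  have hcount := hS.card_coatomSet_bot_mul hy
  rw [hD k (by omega), hD (k + 1) (by omega), pow_succ, factorial_succ] at hcount
  refine Nat.eq_of_mul_eq_mul_right (by positivity : 0 < 2 ^ k * k !) (hcount.trans ?_)
  ring

theorem card_atomSet_bot_mul_eq (hS : IsShefferPoset P B D) (hy : grade ℕ y = k + 2)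
    (hB : IsFactorialUpTo B (k + 1)) (hD : IsCubicalUpTo D (k + 1)) :
    #(atomSet ⊥ y) * (k + 1) = #(coatomSet ⊥ y) * 2 ^ k := by
  refine Nat.eq_of_mul_eq_mul_right k.factorial_pos ?_
  have hcount := (hS.card_atomSet_bot_mul hy).trans (hS.card_coatomSet_bot_mul hy).symm
  rwa [hB (k + 1) le_rfl, hD k (by omega), factorial_succ, ← mul_assoc, ← mul_assoc] at hcount

theorem four_mul_card_atomSet_add (hS : IsShefferPoset P B D) (hE : IsEulerianPoset P)
    (hk : Odd k) (hB : IsFactorialUpTo B (k + 2)) (hD : IsCubicalUpTo D (k + 1))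
    (hy : grade ℕ y = k + 2) (hz : grade ℕ z = k + 3) :
    4 * #(atomSet ⊥ y) + #(coatomSet ⊥ y) * #(atomSet ⊥ z) =
      2 * (k + 2) * #(atomSet ⊥ z) := by
  have htop : k + 3 ≤ grade ℕ (⊤ : P) := hz ▸ grade_le_grade_top z
  have hB' : IsFactorialUpTo B (k + 1) := fun i hi => hB i (by omega)
  have hrel := hS.two_mul_inv_sheffer_sub hE hk.add_one k.succ_ne_zero htop hB' hD
  have hDy := hS.card_atomSet_bot_mul hy
  have hDz := hS.card_atomSet_bot_mul hz
  have hy0 : (#(atomSet ⊥ y) : ℚ) ≠ 0 := mod_cast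
    (card_atomSet_pos (ne_bot_of_grade_ne_zero (by omega)).bot_lt).ne'
  have hz0 : (#(atomSet ⊥ z) : ℚ) ≠ 0 := mod_cast
    (card_atomSet_pos (ne_bot_of_grade_ne_zero (by omega)).bot_lt).ne'
  have hcount : (#(atomSet ⊥ y) : ℚ) * (k + 1) = #(coatomSet ⊥ y) * 2 ^ k :=
    mod_cast hS.card_atomSet_bot_mul_eq hy hB' hD
  rw [← hDy, ← hDz, hB (k + 1) (by omega), hB (k + 2) le_rfl, factorial_succ (k + 1)] at hrel
  push_cast at hrel
  field_simp at hrel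
  rw [← Nat.cast_inj (R := ℚ)]
  push_cast
  refine mul_left_cancel₀ (by positivity : (4 * 2 ^ k * 2 ^ k : ℚ) ≠ 0) ?_
  linear_combination hrel - 4 * 2 ^ k * #(atomSet ⊥ z) * hcount

theorem five_mul_two_pow_le_card_atomSet (hS : IsShefferPoset P B D)
    (hB : IsFactorialUpTo B (k + 2)) (hD : IsCubicalUpTo D (k + 2)) (hy : grade ℕ y = k + 3)
    (hlarge : 2 ^ (k + 2) < #(atomSet ⊥ y)) : 5 * 2 ^ k ≤ #(atomSet ⊥ y) := by
  have hupper : IsUpperBooleanInterval ⊥ y := hS.isUpperBooleanInterval hB (by omega)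
  have grade_coatom {a : P} (ha : a ∈ coatomSet ⊥ y) : grade ℕ a = k + 2 := by
    have := grade_eq_add_one_of_covBy (mem_coatomSet.1 ha).2
    omega
  have card_atoms {a : P} (ha : a ∈ coatomSet ⊥ y) : #(atomSet ⊥ a) = 2 ^ (k + 1) :=
    hS.card_atomSet_bot (grade_coatom ha) (hB _ (by omega)) (hD _ (by omega))
  have hy_pos : ⊥ < y := (ne_bot_of_grade_ne_zero (by omega)).bot_lt
  obtain ⟨b, -, hby⟩ := exists_le_covBy_of_lt hy_pos
  have hb : b ∈ coatomSet ⊥ y := mem_coatomSet.2 ⟨bot_le, hby⟩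
  have hcard : #(coatomSet ⊥ b) + 1 < #(coatomSet ⊥ y) := by
    have hcount := hS.card_atomSet_bot_mul_eq hy hB hD
    rw [hS.card_coatomSet_bot (grade_coatom hb) hD]
    refine Nat.lt_of_mul_lt_mul_right (a := 2 ^ (k + 1)) ?_
    rw [← hcount]
    rw [pow_succ] at hlarge
    nlinarith [Nat.two_pow_pos (k + 1)]
  obtain ⟨b', hb', hdisj⟩ := hupper.exists_disjoint_atomSet hb hcard
  have hle := hupper.card_add_card_add_le_card_atomSet (d := 2 ^ k)
    (by rw [grade_bot_eq_zero]; omega) hb hb' hdisj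
    (by rwa [card_atoms hb, card_atoms hb', ← two_mul, ← pow_succ'])
    (fun a ha => card_atoms ha ▸ pow_dvd_pow 2 k.le_succ) fun a ha c hca => by
      have := grade_eq_add_one_of_covBy hca
      have := grade_coatom ha
      exact hS.card_atomSet_bot (by omega) (hB _ (by omega)) (hD _ (by omega))
  rw [card_atoms hb, card_atoms hb', pow_succ] at hle
  omega

theorem card_atomSet_bot_le_two_pow (hS : IsShefferPoset P B D) (hk : k ≠ 0)
    (hB : IsFactorialUpTo B (k + 2)) (hD : IsCubicalUpTo D (k + 2)) (hy : grade ℕ y = k + 3)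
    (hcoatom : #(coatomSet ⊥ y) < 2 * (k + 3)) : #(atomSet ⊥ y) ≤ 2 ^ (k + 2) := by
  by_contra! hlarge
  have hfive := hS.five_mul_two_pow_le_card_atomSet hB hD hy hlarge
  have hcount := hS.card_atomSet_bot_mul_eq hy hB hD
  have hcoatom' : #(coatomSet ⊥ y) ≤ 2 * k + 5 := by omega
  have : 2 ^ k * (5 * (k + 2)) ≤ 2 ^ k * (2 * (2 * k + 5)) := calc
    2 ^ k * (5 * (k + 2)) = 5 * 2 ^ k * (k + 2) := by ring
    _ ≤ #(atomSet ⊥ y) * (k + 1 + 1) := Nat.mul_le_mul_right _ hfive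
    _ = #(coatomSet ⊥ y) * 2 ^ (k + 1) := hcount
    _ ≤ (2 * k + 5) * 2 ^ (k + 1) := Nat.mul_le_mul_right _ hcoatom'
    _ = 2 ^ k * (2 * (2 * k + 5)) := by ring
  have := Nat.le_of_mul_le_mul_left this (Nat.two_pow_pos k)
  omega

theorem two_mul_card_atomSet_bot_le (hS : IsShefferPoset P B D)
    (hB : IsFactorialUpTo B (k + 2)) (hD : IsCubicalUpTo D (k + 1)) (hy : grade ℕ y = k + 2)
    (hz : grade ℕ z = k + 3) (hsmall : #(atomSet ⊥ y) < 2 ^ (k + 1)) :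
    2 * #(atomSet ⊥ y) ≤ #(atomSet ⊥ z) + 2 ^ k := by
  classical
  have hupper : IsUpperBooleanInterval ⊥ z := hS.isUpperBooleanInterval hB (by omega)
  have grade_coatom {a : P} (ha : a ∈ coatomSet ⊥ z) : grade ℕ a = k + 2 := by
    have := grade_eq_add_one_of_covBy (mem_coatomSet.1 ha).2
    omega
  have card_atoms {a : P} (ha : a ∈ coatomSet ⊥ z) : #(atomSet ⊥ a) = #(atomSet ⊥ y) := by
    refine Nat.eq_of_mul_eq_mul_right (k + 1).factorial_pos ?_
    rw [← hB (k + 1) (by omega), hS.card_atomSet_bot_mul (grade_coatom ha),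
      hS.card_atomSet_bot_mul hy]
  obtain ⟨a, ha, b, hb, hab, u, hbu, hua, hub⟩ :=
    hupper.exists_sharesAtom bot_le (by rw [grade_bot_eq_zero]; omega)
  have hgrade_a := grade_coatom ha
  have hinter_pos : 0 < #(atomSet ⊥ a ∩ atomSet ⊥ b) :=
    card_pos.2 ⟨u, mem_inter.2 ⟨mem_atomSet.2 ⟨hbu, hua⟩, mem_atomSet.2 ⟨hbu, hub⟩⟩⟩
  have hinter : #(atomSet ⊥ a ∩ atomSet ⊥ b) = 2 ^ k := by
    obtain ⟨q, hq⟩ := hupper.dvd_card_atomSet_inter ha hb hab (w := 2 ^ k)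
      fun c _ hca _ => by
        have := grade_eq_add_one_of_covBy hca
        exact hS.card_atomSet_bot (by omega) (hB k (by omega)) (hD k (by omega))
    have hle := card_le_card (inter_subset_left (s₁ := atomSet ⊥ a) (s₂ := atomSet ⊥ b))
    rw [card_atoms ha] at hle
    obtain rfl : q = 1 := by
      rw [pow_succ] at hsmall
      have : q < 2 := Nat.lt_of_mul_lt_mul_left ((hq ▸ hle).trans_lt hsmall)
      have : q ≠ 0 := by rintro rfl; omega
      omega
    rw [hq, mul_one]
  have hunion : #(atomSet ⊥ a ∪ atomSet ⊥ b) ≤ #(atomSet ⊥ z) :=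
    card_le_card (union_subset (atomSet_subset_atomSet (mem_coatomSet.1 ha).2.le)
      (atomSet_subset_atomSet (mem_coatomSet.1 hb).2.le))
  have := card_union_add_card_inter (atomSet ⊥ a) (atomSet ⊥ b)
  rw [card_atoms ha, card_atoms hb, hinter] at this
  omega

theorem two_pow_le_card_atomSet_bot (hS : IsShefferPoset P B D) (hE : IsEulerianPoset P)
    (hk : Odd k) (hk1 : 1 < k) (hB : IsFactorialUpTo B (k + 2)) (hD : IsCubicalUpTo D (k + 1))
    (hy : grade ℕ y = k + 2) (hz : grade ℕ z = k + 3) (hyz : y ≤ z) :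
    2 ^ (k + 1) ≤ #(atomSet ⊥ y) := by
  by_contra! hsmall
  have hinter := hS.two_mul_card_atomSet_bot_le hB hD hy hz hsmall
  have heuler := hS.four_mul_card_atomSet_add hE hk hB hD hy hz
  have hcount := hS.card_atomSet_bot_mul_eq hy (fun i hi => hB i (by omega)) hD
  have hle := card_le_card (atomSet_subset_atomSet (x := ⊥) hyz)
  have hpos := card_atomSet_pos (ne_bot_of_grade_ne_zero (x := y) (by omega)).bot_lt
  have hw := Nat.two_pow_pos k
  rw [pow_succ] at hsmall
  have hc_lt : #(coatomSet ⊥ y) < 2 * (k + 1) :=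
    Nat.lt_of_mul_lt_mul_right (a := 2 ^ k) (by nlinarith)
  have hc_ge : 2 * k ≤ #(coatomSet ⊥ y) := by nlinarith
  obtain hc | hc : #(coatomSet ⊥ y) = 2 * k ∨ #(coatomSet ⊥ y) = 2 * k + 1 := by omega
  · rw [hc] at heuler hcount
    nlinarith
  · rw [hc] at heuler hcount
    nlinarith

theorem isCubicalUpTo_add_two (hS : IsShefferPoset P B D) (hE : IsEulerianPoset P)
    (hk : Odd k) (hk1 : 1 < k) (htop : k + 3 ≤ grade ℕ (⊤ : P)) (hB : IsFactorialUpTo B (k + 2))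
    (hD : IsCubicalUpTo D (k + 1)) : IsCubicalUpTo D (k + 3) := by
  have hB' : IsFactorialUpTo B (k + 1) := fun i hi => hB i (by omega)
  obtain ⟨z, hz⟩ := exists_grade_eq htop
  obtain ⟨y, hy⟩ := rankSet_nonempty (x := (⊥ : P)) (y := z) (i := k + 2) bot_le (by simp)
    (by omega)
  obtain ⟨-, hyz, hyk⟩ := mem_rankSet.1 hy
  have hcard : #(atomSet ⊥ y) = 2 ^ (k + 1) := by
    refine le_antisymm ?_ (hS.two_pow_le_card_atomSet_bot hE hk hk1 hB hD hyk hz hyz)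
    obtain ⟨j, rfl⟩ := Nat.exists_eq_add_of_le' hk1.le
    refine hS.card_atomSet_bot_le_two_pow (by omega) hB' hD hyk ?_
    have heuler := hS.four_mul_card_atomSet_add hE hk hB hD hyk hz
    have hpos := hS.two_pow_le_card_atomSet_bot hE hk hk1 hB hD hyk hz hyz
    have := Nat.two_pow_pos (j + 1 + 1)
    exact Nat.lt_of_mul_lt_mul_right (a := #(atomSet ⊥ z)) (by linarith)
  refine hS.isCubicalUpTo_succ hE hk.add_one k.succ_ne_zero htop hB (hD.succ ?_)
  rw [← hS.card_atomSet_bot_mul hyk, hcard, hB' _ le_rfl]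

end IsShefferPoset

end InductiveStep

section Cube

open Finset Function
open scoped Nat

namespace SegmentFace

instance instFintype : Fintype SegmentFace :=
  ⟨{left, right, whole}, by rintro (_ | _ | _) <;> simp⟩

theorem covBy_iff {a b : SegmentFace} : a ⋖ b ↔ a ≠ whole ∧ b = whole := by
  constructor
  · intro h
    have hb : b = whole := h.le.resolve_left h.ne
    exact ⟨fun ha => h.ne (ha.trans hb.symm), hb⟩
  · rintro ⟨ha, rfl⟩
    exact ⟨lt_of_le_of_ne (Or.inr rfl) ha,
      fun c hac hc => hc.ne (hac.le.resolve_left hac.ne)⟩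

end SegmentFace

namespace CubicalLattice

variable {d : ℕ} {f g : Fin d → SegmentFace}

noncomputable instance instLocallyFiniteOrder : LocallyFiniteOrder (CubicalLattice d) := by
  classical exact Fintype.toLocallyFiniteOrder

theorem grade_coe (g : Fin d → SegmentFace) : grade ℕ (g : CubicalLattice d) = dim g + 1 := rfl

theorem grade_top : grade ℕ (⊤ : CubicalLattice d) = d + 1 := by
  have hwhole : ∀ i ∈ (univ : Finset (Fin d)), (⊤ : Fin d → SegmentFace) i = .whole :=
    fun _ _ => rfl
  rw [← WithBot.coe_top, grade_coe, dim, filter_true_of_mem hwhole, card_fin]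

theorem coe_covBy_coe_iff : (f : CubicalLattice d) ⋖ g ↔
    ∃ i b, g i = .whole ∧ b ≠ .whole ∧ f = update g i b := by
  simp only [WithBot.coe_covBy_coe, Pi.covBy_iff_exists_left_eq, SegmentFace.covBy_iff, and_assoc,
    and_left_comm]

theorem eq_and_eq_of_update_eq_update {i j : Fin d} {b c : SegmentFace} (hi : g i = .whole)
    (hb : b ≠ .whole) (h : update g i b = update g j c) : i = j ∧ b = c := by
  have hval := congrFun h i
  rw [update_self] at hval
  obtain rfl | hij := eq_or_ne i j
  · exact ⟨rfl, hval.trans (update_self ..)⟩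
  · exact absurd (hval.trans ((update_of_ne hij ..).trans hi)) hb

theorem card_coatomSet_bot (hg : dim g ≠ 0) :
    #(coatomSet ⊥ (g : CubicalLattice d)) = 2 * dim g := by
  have himage : coatomSet ⊥ (g : CubicalLattice d) =
      (({i | g i = .whole} : Finset (Fin d)) ×ˢ ({.left, .right} : Finset SegmentFace)).image
        fun p => (update g p.1 p.2 : CubicalLattice d) := by
    have hpair (b : SegmentFace) : b = .left ∨ b = .right ↔ b ≠ .whole := by cases b <;> simp
    ext z
    simp only [mem_coatomSet, bot_le, true_and, mem_image, mem_product, mem_filter_univ, mem_insert,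
      mem_singleton, Prod.exists, hpair]
    induction z using WithBot.recBotCoe with
    | bot => simpa using fun h => hg (dim_eq_zero_of_bot_covBy h)
    | coe e => simp only [coe_covBy_coe_iff, WithBot.coe_inj, and_assoc, eq_comm]
  rw [himage, card_image_of_injOn, card_product, card_pair (by simp), dim, mul_comm]
  rintro ⟨i, b⟩ hi ⟨j, c⟩ - hij
  have hib : g i = .whole ∧ (b = .left ∨ b = .right) := by simpa using hi
  obtain ⟨rfl, rfl⟩ := eq_and_eq_of_update_eq_update hib.1 (by rcases hib.2 with rfl | rfl <;> simp)
    (WithBot.coe_injective hij)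
  rfl

theorem card_coatomSet_coe (hfg : f ≤ g) :
    #(coatomSet (f : CubicalLattice d) g) = dim g - dim f := by
  have himage : coatomSet (f : CubicalLattice d) g =
      (({i | g i = .whole} : Finset (Fin d)) \ ({i | f i = .whole} : Finset (Fin d))).image
        fun i => (update g i (f i) : CubicalLattice d) := by
    ext z
    simp only [mem_coatomSet, mem_image, mem_sdiff, mem_filter_univ]
    constructor
    · rintro ⟨hfz, hzg⟩
      induction z using WithBot.recBotCoe with
      | bot => simp at hfz
      | coe e =>
        obtain ⟨i, b, hi, hb, rfl⟩ := coe_covBy_coe_iff.1 hzg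
        have hfi : f i = b := by
          have hle := WithBot.coe_le_coe.1 hfz i
          rw [update_self] at hle
          exact hle.resolve_right hb
        exact ⟨i, ⟨hi, hfi ▸ hb⟩, hfi ▸ rfl⟩
    · rintro ⟨i, ⟨hi, hfi⟩, rfl⟩
      exact ⟨WithBot.coe_le_coe.2 (le_update_iff.2 ⟨le_rfl, fun j _ => hfg j⟩),
        coe_covBy_coe_iff.2 ⟨i, f i, hi, hfi, rfl⟩⟩
  have hsubset : ({i | f i = .whole} : Finset (Fin d)) ⊆ ({i | g i = .whole} : Finset (Fin d)) :=
    monotone_filter_right _ fun i _ hi => (hfg i).elim (fun h => h ▸ hi) id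
  rw [himage, card_image_of_injOn, card_sdiff_of_subset hsubset, dim, dim]
  intro i hi j _ hij
  have hi' : g i = .whole ∧ f i ≠ .whole := by simpa using hi
  exact (eq_and_eq_of_update_eq_update hi'.1 hi'.2 (WithBot.coe_injective hij)).1

theorem numMaxChains_coe (hfg : f ≤ g) {k : ℕ} (hk : dim g = dim f + k) :
    numMaxChains (f : CubicalLattice d) g = k ! := by
  induction k generalizing g with
  | zero =>
    rw [eq_of_le_of_grade_le (WithBot.coe_le_coe.2 hfg) (by rw [grade_coe, grade_coe, hk]),
      numMaxChains_self, Nat.factorial_zero]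
  | succ k ih =>
    have hlt : f < g := hfg.lt_of_ne (by rintro rfl; omega)
    rw [numMaxChains_eq_sum_coatomSet (WithBot.coe_lt_coe.2 hlt), sum_const_nat (m := k !),
      card_coatomSet_coe hfg, hk, Nat.add_sub_cancel_left, Nat.factorial_succ]
    intro z hz
    obtain ⟨hfz, hzg⟩ := mem_coatomSet.1 hz
    induction z using WithBot.recBotCoe with
    | bot => simp at hfz
    | coe e =>
      have hdim := dim_covBy (WithBot.coe_covBy_coe.1 hzg)
      exact ih (WithBot.coe_le_coe.1 hfz) (by omega)

theorem numMaxChains_bot {k : ℕ} (hk : dim g = k) :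
    numMaxChains (⊥ : CubicalLattice d) g = 2 ^ k * k ! := by
  induction k generalizing g with
  | zero =>
    rw [numMaxChains_of_covBy (covBy_of_le_of_grade_eq bot_le
      (by rw [grade_coe, hk, grade_bot_eq_zero])), Nat.factorial_zero, pow_zero, mul_one]
  | succ k ih =>
    rw [numMaxChains_eq_sum_coatomSet (WithBot.bot_lt_coe g), sum_const_nat (m := 2 ^ k * k !),
      card_coatomSet_bot (by omega), hk, Nat.factorial_succ, pow_succ]
    · ring
    intro z hz
    have hzg := (mem_coatomSet.1 hz).2
    induction z using WithBot.recBotCoe with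
    | bot => exact absurd (dim_eq_zero_of_bot_covBy hzg) (by omega)
    | coe e =>
      have hdim := dim_covBy (WithBot.coe_covBy_coe.1 hzg)
      exact ih (by omega)

theorem isShefferPoset {B D : ℕ → ℕ} (hB : IsFactorialUpTo B d) (hD0 : D 0 = 1)
    (hD : IsCubicalUpTo D (d + 1)) : IsShefferPoset (CubicalLattice d) B D where
  sheffer_interval y := by
    have htop := grade_le_grade_top y
    rw [grade_top] at htop
    induction y using WithBot.recBotCoe with
    | bot => rw [numMaxChains_self, grade_bot_eq_zero, hD0]
    | coe g => rw [numMaxChains_bot rfl, grade_coe, hD (dim g) htop]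
  binomial_interval x y hx hxy := by
    have htop := grade_le_grade_top y
    rw [grade_top] at htop
    induction x using WithBot.recBotCoe with
    | bot => exact absurd rfl hx
    | coe f =>
      induction y using WithBot.recBotCoe with
      | bot => simp at hxy
      | coe g =>
        have hfg := WithBot.coe_le_coe.1 hxy
        rw [grade_coe] at htop
        rw [grade_coe, grade_coe, Nat.add_sub_add_right, hB _ (by omega)]
        exact numMaxChains_coe hfg (Nat.add_sub_of_le (dim_strictMono.monotone hfg)).symm

end CubicalLattice

end Cube

section EulerianSheffer

open scoped Nat

variable {P : Type*} [PartialOrder P] [BoundedOrder P] [GradeMinOrder ℕ P] {B D : ℕ → ℕ}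

namespace IsShefferPoset

variable [LocallyFiniteOrder P]

theorem isCubicalUpTo_two (hS : IsShefferPoset P B D) (hE : IsEulerianPoset P)
    (htop : 2 ≤ grade ℕ (⊤ : P)) : IsCubicalUpTo D 2 := fun i hi => by
  interval_cases i
  · exact hS.sheffer_one (by omega)
  · exact hS.sheffer_two hE htop

theorem isFactorialUpTo_one (hS : IsShefferPoset P B D) (htop : 1 < grade ℕ (⊤ : P)) :
    IsFactorialUpTo B 1 := fun i hi => by
  interval_cases i
  · exact hS.binomial_zero (by omega)
  · exact hS.binomial_one htop

theorem isFactorialUpTo_and_isCubicalUpTo (hS : IsShefferPoset P B D) (hE : IsEulerianPoset P)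
    (hB : B 3 = 3!) (hD : D 3 = 8) {m : ℕ} (hm : 2 * m + 2 ≤ grade ℕ (⊤ : P)) :
    IsFactorialUpTo B (2 * m + 1) ∧ IsCubicalUpTo D (2 * m + 2) := by
  induction m with
  | zero => exact ⟨hS.isFactorialUpTo_one hm, hS.isCubicalUpTo_two hE hm⟩
  | succ m ih =>
    obtain ⟨hBm, hDm⟩ := ih (by omega)
    have hodd : Odd (2 * m + 1) := odd_two_mul_add_one m
    have hBeven := hBm.succ (hS.binomial_succ_eq_factorial_of_odd hE hodd (by omega) hBm)
    obtain rfl | hm0 := eq_or_ne m 0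
    · have hB3 : IsFactorialUpTo B 3 := hBeven.succ hB
      exact ⟨hB3, hS.isCubicalUpTo_succ hE even_two two_ne_zero hm hB3 (hDm.succ hD)⟩
    · have hBodd : IsFactorialUpTo B (2 * m + 3) := hBeven.succ
        (hS.binomial_add_two_eq_factorial hE hodd (by omega) hm hBeven hDm)
      exact ⟨hBodd, hS.isCubicalUpTo_add_two (k := 2 * m + 1) hE hodd (by omega) hm hBodd hDm⟩

end IsShefferPoset

theorem mainTheorem7_general [Finite P] (m : ℕ) (hrank : 2 * m + 2 ≤ grade ℕ (⊤ : P))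
    (hE : IsEulerianPoset P) (hS : IsShefferPoset P B D) (hB : B 3 = 3!) (hD : D 3 = 8) :
    IsShefferPoset (CubicalLattice (2 * m + 1)) B D ∧
    (∀ k : ℕ, 1 ≤ k → k ≤ 2 * m + 2 → D k = 2 ^ (k - 1) * (k - 1)!) ∧
    (∀ k : ℕ, 1 ≤ k → k ≤ 2 * m + 1 → B k = k !) := by
  classical
  have := Fintype.ofFinite P
  let _ : LocallyFiniteOrder P := Fintype.toLocallyFiniteOrder
  obtain ⟨hBm, hDm⟩ := hS.isFactorialUpTo_and_isCubicalUpTo hE hB hD hrank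
  refine ⟨CubicalLattice.isShefferPoset hBm hS.sheffer_zero hDm, fun k hk hkm => ?_,
    fun k _ => hBm k⟩
  rw [← hDm (k - 1) (by omega), Nat.sub_add_cancel hk]

end EulerianSheffer

theorem mainTheorem7 {P : Type*} [PartialOrder P] [BoundedOrder P] [Finite P]
    [GradeMinOrder ℕ P] (m : ℕ) (hm : 6 ≤ 2 * m + 2) (hrank : grade ℕ (⊤ : P) = 2 * m + 2)
    (hE : IsEulerianPoset P) (B D : ℕ → ℕ) (hS : IsShefferPoset P B D)
    (hB : B 3 = Nat.factorial 3) (hD : D 3 = 8) :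
    (grade ℕ (⊤ : CubicalLattice (2 * m + 1)) = 2 * m + 2 ∧
      IsShefferPoset (CubicalLattice (2 * m + 1)) B D) ∧
    (∀ k : ℕ, 1 ≤ k → k ≤ 2 * m + 2 → D k = 2 ^ (k - 1) * Nat.factorial (k - 1)) ∧
    (∀ k : ℕ, 1 ≤ k → k ≤ 2 * m + 1 → B k = Nat.factorial k) := by
  obtain ⟨hcube, hvalues⟩ := mainTheorem7_general m hrank.ge hE hS hB hD
  exact ⟨⟨CubicalLattice.grade_top, hcube⟩, hvalues⟩
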